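/- Let $L\in\mathbb N=\{1,2,\dots\}$, $(\ell_k)_{k\in\mathbb N_0}\subseteq\mathbb N$, $\mathfrak d=\sum_{k=1}^L\ell_k(\ell_{k-1}+1)$, $\xi\in\mathbb R^{\ell_L}$, $a<b$ real, $\mathbf a=\max\{|a|,|b|,1\}$, and let $\|\cdot\|$ be the Euclidean norm. For $\theta\in\mathbb R^{\mathfrak d}$ and $k\in\{1,\dots,L\}$ let $w^{k,\theta}\in\mathbb R^{\ell_k\times\ell_{k-1}}$ and $b^{k,\theta}\in\mathbb R^{\ell_k}$ be given by $$w^{k,\theta}_{i,j}=\theta_{(i-1)\ell_{k-1}+j+\sum_{h=1}^{k-1}\ell_h(\ell_{h-1}+1)},\qquad b^{k,\theta}_i=\theta_{\ell_k\ell_{k-1}+i+\sum_{h=1}^{k-1}\ell_h(\ell_{h-1}+1)} .$$ Let $0<A<B$, let $R_\infty(y)=\max\{y,0\}$, and let $R_r\in C^1(\mathbb R,\mathbb R)$, $r\in[1,\infty)$, satisfy $R_r(x)=0$ for $x\le A/r$, $0\le R_r\le R_\infty$, $R_r(z)=z$ for $z\ge B/r$, and $\sup_{r\in[1,\infty)}\sup_x|R_r'(x)|<\infty$.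 For $r\in[1,\infty]$ and $\theta\in\mathbb R^{\mathfrak d}$ define $N^{1,\theta}_r(x)=b^{1,\theta}+w^{1,\theta}x$ for $x\in\mathbb R^{\ell_0}$ and $$N^{k+1,\theta}_r(x)=b^{k+1,\theta}+w^{k+1,\theta}R_{r^{1/k}}(N^{k,\theta}_r(x)),\qquad 1\le k<L,$$ with $R_{r^{1/k}}$ applied componentwise (and $\infty^{1/k}=\infty$). Let $(\Omega,\mathcal F,\mathbb P)$ be a probability space, let $X^{n,m}\colon\Omega\to[a,b]^{\ell_0}$, $n,m\in\mathbb N_0$, be i.i.d. random variables, let $M_n\in\mathbb N$ for $n\in\mathbb N_0$, and define $$\mathcal L(\theta)=\mathbb E\big[\|N^{L,\theta}_\infty(X^{0,0})-\xi\|^2\big],\qquad \mathfrak L^n_r(\theta,\omega)=\frac1{M_n}\sum_{m=1}^{M_n}\|N^{L,\theta}_r(X^{n,m}(\omega))-\xi\|^2 ,$$ $$V(\theta)=\sum_{k=1}^L\Big(k\|b^{k,\theta}\|^2+\sum_{i=1}^{\ell_k}\sum_{j=1}^{\ell_{k-1}}|w^{k,\theta}_{i,j}|^2\Big)-2L\langle\xi,b^{L,\theta}\rangle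 .$$ For $n\in\mathbb N_0$ let $\mathfrak G^n\colon\mathbb R^{\mathfrak d}\times\Omega\to\mathbb R^{\mathfrak d}$ satisfy $\mathfrak G^n(\theta,\omega)=\lim_{r\to\infty}\nabla_\theta\mathfrak L^n_r(\theta,\omega)$ whenever this limit exists. Let $(\gamma_n)_{n\in\mathbb N_0}\subseteq[0,\infty)$ with $\sum_{n=0}^\infty\gamma_n=\infty$, and let $(\Theta_n)_{n\in\mathbb N_0}$ be an $\mathbb R^{\mathfrak d}$-valued stochastic process such that $\Theta_0$ is independent of $(X^{n,m})_{n,m\in\mathbb N_0}$ and $\Theta_{n+1}(\omega)=\Theta_n(\omega)-\gamma_n\mathfrak G^n(\Theta_n(\omega),\omega)$ for all $n\in\mathbb N_0$, $\omega\in\Omega$. Consider the following statements: (i) there is $C\in\mathbb R$ with $\mathbb P(\sup_{n\in\mathbb N_0}\|\Theta_n\|\le C)=1$; (ii) $\mathbb P(\limsup_{n\to\infty}\mathcal L(\Theta_n)=0)=1$; (iii) $\mathbb E[\mathcal L(\Theta_n)]<\infty$ for all $n\in\mathbb N_0$, and $\limsup_{n\to\infty}\mathbb E[\mathcal L(\Theta_n)]=0$.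 **Theorem.** Let $\delta\in(0,1)$ be such that for every $n\in\mathbb N_0$ it holds a.s. that $$\gamma_n\,L\,\mathbf a^2\Big[\prod_{p=0}^L(\ell_p+1)\Big]\big(2V(\Theta_0)+4L^2\|\xi\|^2+1\big)^{L-1}\le\delta .$$ Then (ii) holds. If $L\ge2$, or if $L=1$ and there is $c\in\mathbb R$ with $\mathbb P(\|\Theta_0\|\le c)=1$, then (i) and (iii) hold as well. **Corollary.** If for every $n\in\mathbb N_0$ it holds a.s. that $$(4L\mathfrak d\max\{\mathbf a,\|\xi\|\})^{2L}\gamma_n\le(\|\Theta_0\|+1)^{-2L},$$ then (i), (ii) and (iii) hold. -/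

import Mathlib

open MeasureTheory ProbabilityTheory Filter Topology

namespace DeepReLU

/-- The number of real parameters of the first `k` layers of a fully connected network with layer
widths `ℓ 0, ℓ 1, ℓ 2, …`, that is, `∑_{h = 1}^k ℓ_h (ℓ_{h-1} + 1)`. -/
def paramCount (ℓ : ℕ → ℕ) (k : ℕ) : ℕ :=
  ∑ h ∈ Finset.range k, ℓ (h + 1) * (ℓ h + 1)

/-- The coordinate number `n` (counted from `0`) of a vector; `0` beyond the last coordinate. -/
noncomputable def coord {d : ℕ} (θ : EuclideanSpace ℝ (Fin d)) (n : ℕ) : ℝ :=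
  if h : n < d then θ ⟨n, h⟩ else 0

/-- The entry `(i, j)` of the weight matrix of layer `k ≥ 1`, read off from the parameter vector:
layer after layer, first the weight matrix row by row, then the bias. -/
noncomputable def weight (ℓ : ℕ → ℕ) {d : ℕ} (θ : EuclideanSpace ℝ (Fin d)) (k : ℕ)
    (i : Fin (ℓ k)) (j : Fin (ℓ (k - 1))) : ℝ :=
  coord θ (i * ℓ (k - 1) + j + paramCount ℓ (k - 1))

/-- The bias vector of layer `k ≥ 1`, read off from the parameter vector. -/
noncomputable def bias (ℓ : ℕ → ℕ) {d : ℕ} (θ : EuclideanSpace ℝ (Fin d)) (k : ℕ) :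
    EuclideanSpace ℝ (Fin (ℓ k)) :=
  WithLp.toLp 2 fun i => coord θ (ℓ k * ℓ (k - 1) + i + paramCount ℓ (k - 1))

/-- The affine map `x ↦ b^k + w^k x` of layer `k ≥ 1`. -/
noncomputable def affine (ℓ : ℕ → ℕ) {d : ℕ} (θ : EuclideanSpace ℝ (Fin d)) (k : ℕ)
    (x : EuclideanSpace ℝ (Fin (ℓ (k - 1)))) : EuclideanSpace ℝ (Fin (ℓ k)) :=
  WithLp.toLp 2 fun i => bias ℓ θ k i + ∑ j, weight ℓ θ k i j * x j

/-- The output of layer `k` (before activation) when the function `σ k` is applied componentwise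
between the layers `k` and `k + 1`, for `k ≥ 1`; layer `0` is the input, which is fed into the
first affine map without activation. -/
noncomputable def realization (ℓ : ℕ → ℕ) {d : ℕ} (σ : ℕ → ℝ → ℝ)
    (θ : EuclideanSpace ℝ (Fin d)) :
    (k : ℕ) → EuclideanSpace ℝ (Fin (ℓ 0)) → EuclideanSpace ℝ (Fin (ℓ k))
  | 0, x => x
  | 1, x => affine ℓ θ 1 x
  | k + 2, x =>
      affine ℓ θ (k + 2) (WithLp.toLp 2 fun i => σ (k + 1) (realization ℓ σ θ (k + 1) x i))

/-- The rectifier activation in every layer. -/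
noncomputable def relu : ℕ → ℝ → ℝ := fun _ y => max y 0

/-- The approximate activation `R_{r^{1/k}}` after layer `k`, for finite `r`. -/
noncomputable def approxAct (R : ℝ → ℝ → ℝ) (r : ℝ) : ℕ → ℝ → ℝ :=
  fun k => R (r ^ (1 / (k : ℝ)))

/-- `(R_r)_{r ∈ [1, ∞)}` is a family of continuously differentiable approximations of the
rectifier function which vanish on `(-∞, A / r]`, are the identity on `[B / r, ∞)`, lie between
`0` and the rectifier function, and have uniformly bounded derivatives. -/
structure IsRectifierApprox (A B : ℝ) (R : ℝ → ℝ → ℝ) : Prop where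
  contDiff : ∀ r, 1 ≤ r → ContDiff ℝ 1 (R r)
  eq_zero : ∀ r, 1 ≤ r → ∀ x, x ≤ A * r⁻¹ → R r x = 0
  nonneg : ∀ r, 1 ≤ r → ∀ y, 0 ≤ R r y
  le_relu : ∀ r, 1 ≤ r → ∀ y, R r y ≤ max y 0
  eq_self : ∀ r, 1 ≤ r → ∀ z, B * r⁻¹ ≤ z → R r z = z
  deriv_bdd : ∃ C : ℝ, ∀ r, 1 ≤ r → ∀ x, |deriv (R r) x| ≤ C

/-- The true risk `E ‖N_∞^{L,θ}(X) - ξ‖²` of the ReLU network with constant target `ξ`. -/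
noncomputable def risk (ℓ : ℕ → ℕ) (L : ℕ) (ξ : EuclideanSpace ℝ (Fin (ℓ L)))
    {Ω : Type*} [MeasurableSpace Ω] (P : Measure Ω) (X : Ω → EuclideanSpace ℝ (Fin (ℓ 0)))
    (θ : EuclideanSpace ℝ (Fin (paramCount ℓ L))) : ℝ :=
  ∫ ω, ‖realization ℓ relu θ L (X ω) - ξ‖ ^ 2 ∂P

/-- The empirical risk `(1/M) ∑_{m=1}^M ‖N^{L,θ}(x_m) - ξ‖²` of the network with activations
`σ` on the data `x_1, …, x_M`. -/
noncomputable def empRisk (ℓ : ℕ → ℕ) (L : ℕ) (ξ : EuclideanSpace ℝ (Fin (ℓ L)))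
    (σ : ℕ → ℝ → ℝ) (M : ℕ) (x : ℕ → EuclideanSpace ℝ (Fin (ℓ 0)))
    (θ : EuclideanSpace ℝ (Fin (paramCount ℓ L))) : ℝ :=
  1 / (M : ℝ) * ∑ m ∈ Finset.Icc 1 M, ‖realization ℓ σ θ L (x m) - ξ‖ ^ 2

/-- The Lyapunov function
`V(θ) = ∑_{k=1}^L (k ‖b^k‖² + ∑_{i,j} |w^k_{i,j}|²) - 2 L ⟨ξ, b^L⟩`. -/
noncomputable def lyapunov (ℓ : ℕ → ℕ) (L : ℕ) (ξ : EuclideanSpace ℝ (Fin (ℓ L)))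
    (θ : EuclideanSpace ℝ (Fin (paramCount ℓ L))) : ℝ :=
  (∑ k ∈ Finset.Icc 1 L,
      ((k : ℝ) * ‖bias ℓ θ k‖ ^ 2 + ∑ i, ∑ j, |weight ℓ θ k i j| ^ 2))
    - 2 * (L : ℝ) * inner ℝ ξ (bias ℓ θ L)

end DeepReLU

namespace DeepReLU

/-! Half the gradient of the Lyapunov function `V` consists of the weights themselves and of `k`
times the biases of layer `k`, those of the last layer being shifted by `-ξ`. Scaling all weights by
`t` and the biases of layer `k` by `t ^ k` multiplies the ReLU output `N` by `t ^ L`. Euler's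
identity and the shift give the generalized derivative `L (N - ξ)` of the output in this direction
(`tangent_lyapunovDir`). So the inner product of the direction with the generalized gradient is
exactly `2 L` times the empirical risk, without any convexity (`inner_lyapunovDir_eq`). The
generalized gradient exists everywhere: at fixed parameters and data, the approximating networks
have, for all large `r`, the same gradient, that of the ReLU network with derivative `0` of the
rectifier at `0`.

`V` is quadratic with coefficients at most `L`, and on bounded sets the squared norm of the gradient
is at most a constant times the empirical risk. A small step therefore lowers `V` by at least `4 L
(1 - δ) γ` times the empirical risk (`lyapunov_descent`). As `V` controls `‖θ‖ ^ 2`, the rate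
condition at the initial value persists, the trajectory stays bounded, and the empirical risks
weighted by the rates are summable.

Each batch is independent of the current parameters, so the expected empirical and true risks agree
on events `‖Θ 0‖ ≤ c`; hence the weighted true risks are summable almost surely
(`ae_summable_risk`). Since the rates have infinite sum, the true risk is infinitely often small. It
is Lipschitz along the bounded trajectory, with increments at most `C γ √e` for the empirical risk
`e`, which rules out infinitely many excursions from `0` (`tendsto_zero_of_summable_of_increments`).
For bounded initial values, dominated convergence gives convergence in mean; for `L ≥ 2`, or under
the explicit condition, a single positive rate already bounds `Θ 0`. -/

theorem sum_Icc_one_eq_sum_range {M : Type*} [AddCommMonoid M] (f : ℕ → M) (n : ℕ) :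
    ∑ k ∈ Finset.Icc 1 n, f k = ∑ k ∈ Finset.range n, f (k + 1) := by
  induction n with
  | zero => simp
  | succ n ih => rw [Finset.sum_Icc_succ_top (by omega), ih, Finset.sum_range_succ]

theorem sum_range_mul (f : ℕ → ℝ) (m n : ℕ) :
    ∑ p ∈ Finset.range (m * n), f p =
      ∑ i ∈ Finset.range m, ∑ j ∈ Finset.range n, f (i * n + j) := by
  induction m with
  | zero => simp
  | succ m ih => rw [Nat.succ_mul, Finset.sum_range_add, ih, Finset.sum_range_succ]

/-! ### Layout of the parameter vector -/

theorem paramCount_succ (ℓ : ℕ → ℕ) (k : ℕ) :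
    paramCount ℓ (k + 1) = paramCount ℓ k + (ℓ (k + 1) * ℓ k + ℓ (k + 1)) := by
  rw [paramCount, Finset.sum_range_succ, ← paramCount]; ring

theorem paramCount_mono (ℓ : ℕ → ℕ) : Monotone (paramCount ℓ) :=
  monotone_nat_of_le_succ fun k => by rw [paramCount_succ]; omega

/-- Summing over all parameters amounts to summing over the layers, first over the weights and
then over the biases of each layer. -/
theorem sum_range_paramCount (ℓ : ℕ → ℕ) (f : ℕ → ℝ) (L : ℕ) :
    ∑ n ∈ Finset.range (paramCount ℓ L), f n =
      ∑ k ∈ Finset.range L,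
        ((∑ i : Fin (ℓ (k + 1)), ∑ j : Fin (ℓ k), f (i * ℓ k + j + paramCount ℓ k)) +
          ∑ i : Fin (ℓ (k + 1)), f (ℓ (k + 1) * ℓ k + i + paramCount ℓ k)) := by
  induction L with
  | zero => simp [paramCount]
  | succ L ih =>
    rw [paramCount_succ, Finset.sum_range_add, ih, Finset.sum_range_succ, Finset.sum_range_add,
      sum_range_mul]
    congr 2
    · rw [Finset.sum_range]
      refine Finset.sum_congr rfl fun i _ => ?_
      rw [Finset.sum_range]
      exact Finset.sum_congr rfl fun j _ => by rw [add_comm]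
    · rw [Finset.sum_range]
      exact Finset.sum_congr rfl fun j _ => by rw [add_comm]

section Coord

variable {d : ℕ}

theorem coord_of_lt (θ : EuclideanSpace ℝ (Fin d)) {n : ℕ} (h : n < d) :
    coord θ n = θ ⟨n, h⟩ := by simp [coord, h]

@[simp] theorem coord_val (θ : EuclideanSpace ℝ (Fin d)) (i : Fin d) : coord θ i = θ i :=
  coord_of_lt θ i.2

@[simp] theorem coord_sub (θ η : EuclideanSpace ℝ (Fin d)) (n : ℕ) :
    coord (θ - η) n = coord θ n - coord η n := by
  by_cases h : n < d <;> simp [coord, h]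

@[simp] theorem coord_smul (c : ℝ) (θ : EuclideanSpace ℝ (Fin d)) (n : ℕ) :
    coord (c • θ) n = c * coord θ n := by
  by_cases h : n < d <;> simp [coord, h]

/-- The coordinate functionals, as continuous linear maps. -/
theorem exists_coord_clm (d n : ℕ) :
    ∃ D : EuclideanSpace ℝ (Fin d) →L[ℝ] ℝ, ∀ h, D h = coord h n := by
  by_cases h : n < d
  · exact ⟨EuclideanSpace.proj ⟨n, h⟩, fun θ => by simp [coord, h]⟩
  · exact ⟨0, fun θ => by simp [coord, h]⟩

theorem norm_sq_eq_sum_coord (θ : EuclideanSpace ℝ (Fin d)) :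
    ‖θ‖ ^ 2 = ∑ n ∈ Finset.range d, coord θ n ^ 2 := by
  rw [EuclideanSpace.real_norm_sq_eq, Finset.sum_range]
  simp

theorem inner_eq_sum_coord (θ η : EuclideanSpace ℝ (Fin d)) :
    inner ℝ θ η = ∑ n ∈ Finset.range d, coord θ n * coord η n := by
  rw [PiLp.inner_apply, Finset.sum_range]
  simp [mul_comm]

end Coord

/-- The layer (counted from `0`) to which the parameter number `n` belongs. -/
def layerOf (ℓ : ℕ → ℕ) (L n : ℕ) : ℕ :=
  ((Finset.range L).filter fun k => paramCount ℓ (k + 1) ≤ n).card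

theorem layerOf_eq (ℓ : ℕ → ℕ) {L k m : ℕ} (hk : k < L)
    (hm : m < ℓ (k + 1) * ℓ k + ℓ (k + 1)) : layerOf ℓ L (m + paramCount ℓ k) = k := by
  have : ((Finset.range L).filter fun j => paramCount ℓ (j + 1) ≤ m + paramCount ℓ k) =
      Finset.range k := by
    ext j
    simp only [Finset.mem_filter, Finset.mem_range]
    constructor
    · rintro ⟨-, h⟩
      by_contra! hj
      have h1 := paramCount_mono ℓ (show k + 1 ≤ j + 1 by omega)
      rw [paramCount_succ] at h1
      omega
    · intro h
      exact ⟨by omega, (paramCount_mono ℓ (show j + 1 ≤ k by omega)).trans (by omega)⟩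
  rw [layerOf, this, Finset.card_range]

/-- The position of the parameter number `n` within its layer. -/
def layerPos (ℓ : ℕ → ℕ) (L n : ℕ) : ℕ := n - paramCount ℓ (layerOf ℓ L n)

theorem layerPos_eq (ℓ : ℕ → ℕ) {L k m : ℕ} (hk : k < L)
    (hm : m < ℓ (k + 1) * ℓ k + ℓ (k + 1)) : layerPos ℓ L (m + paramCount ℓ k) = m := by
  rw [layerPos, layerOf_eq ℓ hk hm]; omega

/-- The coefficient of the square of the parameter number `n` in the Lyapunov function. -/
noncomputable def quadCoeff (ℓ : ℕ → ℕ) (L n : ℕ) : ℝ :=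
  if layerPos ℓ L n < ℓ (layerOf ℓ L n + 1) * ℓ (layerOf ℓ L n) then 1
  else (layerOf ℓ L n : ℝ) + 1

/-- The vector `ξ`, placed at the biases of the last layer. -/
noncomputable def targetCoeff (ℓ : ℕ → ℕ) (L : ℕ) (ξ : EuclideanSpace ℝ (Fin (ℓ L)))
    (n : ℕ) : ℝ :=
  if layerPos ℓ L n < ℓ (layerOf ℓ L n + 1) * ℓ (layerOf ℓ L n) then 0
  else if layerOf ℓ L n + 1 = L then
    coord ξ (layerPos ℓ L n - ℓ (layerOf ℓ L n + 1) * ℓ (layerOf ℓ L n))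
  else 0

/-! ### Coefficients of the Lyapunov function at weights and biases -/

section Index

variable (ℓ : ℕ → ℕ) {L : ℕ} (ξ : EuclideanSpace ℝ (Fin (ℓ L))) {k : ℕ}

theorem weightPos_lt {m n : ℕ} (i : Fin m) (j : Fin n) : (i : ℕ) * n + j < m * n :=
  calc (i : ℕ) * n + j < i * n + n := by omega
    _ = (i + 1) * n := by ring
    _ ≤ m * n := Nat.mul_le_mul_right _ i.2

theorem quadCoeff_weight (hk : k < L) (i : Fin (ℓ (k + 1))) (j : Fin (ℓ k)) :
    quadCoeff ℓ L (i * ℓ k + j + paramCount ℓ k) = 1 := by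
  have h := weightPos_lt i j
  rw [quadCoeff, layerPos_eq ℓ hk (by omega), layerOf_eq ℓ hk (by omega), if_pos h]

theorem quadCoeff_bias (hk : k < L) (i : Fin (ℓ (k + 1))) :
    quadCoeff ℓ L (ℓ (k + 1) * ℓ k + i + paramCount ℓ k) = k + 1 := by
  rw [quadCoeff, layerPos_eq ℓ hk (by omega), layerOf_eq ℓ hk (by omega), if_neg (by omega)]

theorem targetCoeff_weight (hk : k < L) (i : Fin (ℓ (k + 1))) (j : Fin (ℓ k)) :
    targetCoeff ℓ L ξ (i * ℓ k + j + paramCount ℓ k) = 0 := by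
  have h := weightPos_lt i j
  rw [targetCoeff, layerPos_eq ℓ hk (by omega), layerOf_eq ℓ hk (by omega), if_pos h]

theorem targetCoeff_bias (hk : k < L) (i : Fin (ℓ (k + 1))) :
    targetCoeff ℓ L ξ (ℓ (k + 1) * ℓ k + i + paramCount ℓ k) =
      if k + 1 = L then coord ξ i else 0 := by
  rw [targetCoeff, layerPos_eq ℓ hk (by omega), layerOf_eq ℓ hk (by omega), if_neg (by omega)]
  simp

theorem one_le_quadCoeff (n : ℕ) : 1 ≤ quadCoeff ℓ L n := by
  unfold quadCoeff
  split_ifs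
  · exact le_rfl
  · simp

theorem layerOf_lt {n : ℕ} (hn : n < paramCount ℓ L) : layerOf ℓ L n < L := by
  rcases Nat.eq_zero_or_pos L with rfl | hL
  · simp [paramCount] at hn
  have : ((Finset.range L).filter fun k => paramCount ℓ (k + 1) ≤ n) ⊆ Finset.range (L - 1) := by
    intro k
    simp only [Finset.mem_filter, Finset.mem_range]
    rintro ⟨hk, h⟩
    by_contra! hk'
    obtain rfl : k + 1 = L := by omega
    omega
  have := Finset.card_le_card this
  rw [Finset.card_range] at this
  unfold layerOf
  omega

theorem quadCoeff_le {n : ℕ} (hn : n < paramCount ℓ L) : quadCoeff ℓ L n ≤ L := by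
  have h := layerOf_lt ℓ hn
  have h' : (layerOf ℓ L n : ℝ) + 1 ≤ L := by exact_mod_cast h
  unfold quadCoeff
  split_ifs
  · have : (0 : ℝ) ≤ layerOf ℓ L n := by positivity
    linarith
  · exact h'

end Index

/-- The Lyapunov function in coordinates. -/
theorem lyapunov_eq_sum (ℓ : ℕ → ℕ) {L : ℕ} (hL : 1 ≤ L) (ξ : EuclideanSpace ℝ (Fin (ℓ L)))
    (θ : EuclideanSpace ℝ (Fin (paramCount ℓ L))) :
    lyapunov ℓ L ξ θ = ∑ n ∈ Finset.range (paramCount ℓ L),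
      (quadCoeff ℓ L n * coord θ n ^ 2 - 2 * L * (targetCoeff ℓ L ξ n * coord θ n)) := by
  rw [sum_range_paramCount, lyapunov, sum_Icc_one_eq_sum_range]
  have key : ∀ k ∈ Finset.range L, ((∑ i : Fin (ℓ (k + 1)), ∑ j : Fin (ℓ k),
      (quadCoeff ℓ L (i * ℓ k + j + paramCount ℓ k) *
          coord θ (i * ℓ k + j + paramCount ℓ k) ^ 2 -
        2 * L * (targetCoeff ℓ L ξ (i * ℓ k + j + paramCount ℓ k) *
          coord θ (i * ℓ k + j + paramCount ℓ k)))) +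
      ∑ i : Fin (ℓ (k + 1)), (quadCoeff ℓ L (ℓ (k + 1) * ℓ k + i + paramCount ℓ k) *
          coord θ (ℓ (k + 1) * ℓ k + i + paramCount ℓ k) ^ 2 -
        2 * L * (targetCoeff ℓ L ξ (ℓ (k + 1) * ℓ k + i + paramCount ℓ k) *
          coord θ (ℓ (k + 1) * ℓ k + i + paramCount ℓ k)))) =
      (((k + 1 : ℕ) : ℝ) * ‖bias ℓ θ (k + 1)‖ ^ 2 +
          ∑ i, ∑ j, |weight ℓ θ (k + 1) i j| ^ 2) -
        if k + 1 = L then 2 * (L : ℝ) * ∑ i : Fin (ℓ (k + 1)), coord ξ i *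
          bias ℓ θ (k + 1) i else 0 := by
    intro k hk
    rw [Finset.mem_range] at hk
    rw [EuclideanSpace.real_norm_sq_eq, add_comm, add_sub_right_comm]
    congr 1
    · rw [Finset.sum_sub_distrib, Finset.mul_sum]
      congr 1
      · refine Finset.sum_congr rfl fun i _ => ?_
        rw [quadCoeff_bias ℓ hk]
        simp [bias]
      · by_cases h : k + 1 = L
        · simp only [targetCoeff_bias ℓ ξ hk, if_pos h, ← Finset.mul_sum]
          simp [bias]
        · simp [h, targetCoeff_bias ℓ ξ hk]
    · refine Finset.sum_congr rfl fun i _ => Finset.sum_congr rfl fun j _ => ?_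
      rw [quadCoeff_weight ℓ hk, targetCoeff_weight ℓ ξ hk]
      simp [weight]
  rw [Finset.sum_congr rfl key, Finset.sum_sub_distrib]
  congr 1
  obtain ⟨K, rfl⟩ : ∃ K, L = K + 1 := ⟨L - 1, by omega⟩
  simp only [Nat.add_right_cancel_iff, Finset.sum_ite_eq', Finset.mem_range, Nat.lt_succ_self,
    if_true]
  congr 1
  rw [PiLp.inner_apply]
  exact Finset.sum_congr rfl fun i _ => by simp [mul_comm]

theorem sum_targetCoeff_sq (ℓ : ℕ → ℕ) {L : ℕ} (hL : 1 ≤ L) (ξ : EuclideanSpace ℝ (Fin (ℓ L))) :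
    ∑ n ∈ Finset.range (paramCount ℓ L), targetCoeff ℓ L ξ n ^ 2 = ‖ξ‖ ^ 2 := by
  rw [sum_range_paramCount]
  have key : ∀ k ∈ Finset.range L, ((∑ i : Fin (ℓ (k + 1)), ∑ j : Fin (ℓ k),
      targetCoeff ℓ L ξ (i * ℓ k + j + paramCount ℓ k) ^ 2) + ∑ i : Fin (ℓ (k + 1)),
        targetCoeff ℓ L ξ (ℓ (k + 1) * ℓ k + i + paramCount ℓ k) ^ 2) =
      if k + 1 = L then ∑ i : Fin (ℓ (k + 1)), coord ξ i ^ 2 else 0 := by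
    intro k hk
    rw [Finset.mem_range] at hk
    simp only [targetCoeff_weight ℓ ξ hk, targetCoeff_bias ℓ ξ hk]
    split_ifs <;> simp
  rw [Finset.sum_congr rfl key]
  obtain ⟨K, rfl⟩ : ∃ K, L = K + 1 := ⟨L - 1, by omega⟩
  simp [EuclideanSpace.real_norm_sq_eq]

/-! ### Quadratic expansion and coercivity of the Lyapunov function -/

section Lyapunov

variable (ℓ : ℕ → ℕ) {L : ℕ} (ξ : EuclideanSpace ℝ (Fin (ℓ L)))
  (θ : EuclideanSpace ℝ (Fin (paramCount ℓ L)))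

/-- Half the gradient of the Lyapunov function. -/
noncomputable def lyapunovDir : EuclideanSpace ℝ (Fin (paramCount ℓ L)) :=
  WithLp.toLp 2 fun n => quadCoeff ℓ L n * θ n - L * targetCoeff ℓ L ξ n

theorem coord_lyapunovDir {n : ℕ} (hn : n < paramCount ℓ L) :
    coord (lyapunovDir ℓ ξ θ) n = quadCoeff ℓ L n * coord θ n - L * targetCoeff ℓ L ξ n := by
  rw [coord_of_lt _ hn, coord_of_lt _ hn]; rfl

theorem index_lt_paramCount {k m : ℕ} (hk : k < L) (hm : m < ℓ (k + 1) * ℓ k + ℓ (k + 1)) :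
    m + paramCount ℓ k < paramCount ℓ L := by
  have := paramCount_mono ℓ (show k + 1 ≤ L from hk)
  rw [paramCount_succ] at this
  omega

theorem weight_lyapunovDir {k : ℕ} (hk : k < L) (i : Fin (ℓ (k + 1))) (j : Fin (ℓ k)) :
    weight ℓ (lyapunovDir ℓ ξ θ) (k + 1) i j = weight ℓ θ (k + 1) i j := by
  have h := weightPos_lt i j
  have h' := coord_lyapunovDir ℓ ξ θ (index_lt_paramCount ℓ hk (m := i * ℓ k + j) (by omega))
  rw [quadCoeff_weight ℓ hk, targetCoeff_weight ℓ ξ hk] at h'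
  simpa [weight] using h'

theorem bias_lyapunovDir {k : ℕ} (hk : k < L) (i : Fin (ℓ (k + 1))) :
    bias ℓ (lyapunovDir ℓ ξ θ) (k + 1) i =
      (k + 1) * (bias ℓ θ (k + 1) i - if k + 1 = L then coord ξ i else 0) := by
  have h' := coord_lyapunovDir ℓ ξ θ
    (index_lt_paramCount ℓ hk (m := ℓ (k + 1) * ℓ k + i) (by omega))
  rw [quadCoeff_bias ℓ hk, targetCoeff_bias ℓ ξ hk] at h'
  simp only [bias, Nat.add_sub_cancel]
  rw [h']
  split_ifs with h
  · have hL : (L : ℝ) = k + 1 := by exact_mod_cast h.symm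
    rw [mul_sub, hL]
  · ring

/-- The second-order expansion of a quadratic function is exact; only the coefficients of the
squares are replaced by their upper bound `L`. -/
theorem lyapunov_step_le (hL : 1 ≤ L) (γ : ℝ) (g : EuclideanSpace ℝ (Fin (paramCount ℓ L))) :
    lyapunov ℓ L ξ (θ - γ • g) ≤
      lyapunov ℓ L ξ θ - 2 * γ * inner ℝ (lyapunovDir ℓ ξ θ) g + γ ^ 2 * (L * ‖g‖ ^ 2) := by
  rw [lyapunov_eq_sum ℓ hL, lyapunov_eq_sum ℓ hL, inner_eq_sum_coord, norm_sq_eq_sum_coord,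
    Finset.mul_sum, Finset.mul_sum, Finset.mul_sum, ← Finset.sum_sub_distrib,
    ← Finset.sum_add_distrib]
  refine Finset.sum_le_sum fun n hn => ?_
  rw [Finset.mem_range] at hn
  rw [coord_lyapunovDir ℓ ξ θ hn, coord_sub, coord_smul]
  have h := mul_le_mul_of_nonneg_right (quadCoeff_le ℓ hn)
    (mul_nonneg (sq_nonneg γ) (sq_nonneg (coord g n)))
  nlinarith [h]

/-- Coercivity: with coefficients at least `1`, the difference of the two sides is in each
coordinate at least the square of `θ n - 2 L ξ n`, where `ξ` is placed at the last biases. -/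
theorem norm_sq_le_lyapunov (hL : 1 ≤ L) :
    ‖θ‖ ^ 2 ≤ 2 * lyapunov ℓ L ξ θ + 4 * (L : ℝ) ^ 2 * ‖ξ‖ ^ 2 := by
  rw [lyapunov_eq_sum ℓ hL, norm_sq_eq_sum_coord, ← sum_targetCoeff_sq ℓ hL ξ, Finset.mul_sum,
    Finset.mul_sum, ← Finset.sum_add_distrib]
  refine Finset.sum_le_sum fun n hn => ?_
  have h := mul_le_mul_of_nonneg_right (one_le_quadCoeff ℓ (L := L) n) (sq_nonneg (coord θ n))
  nlinarith [sq_nonneg (coord θ n - 2 * L * targetCoeff ℓ L ξ n)]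

theorem lyapunov_le (hL : 1 ≤ L) : lyapunov ℓ L ξ θ ≤ 2 * L * ‖θ‖ ^ 2 + L * ‖ξ‖ ^ 2 := by
  rw [lyapunov_eq_sum ℓ hL, norm_sq_eq_sum_coord, ← sum_targetCoeff_sq ℓ hL ξ, Finset.mul_sum,
    Finset.mul_sum, ← Finset.sum_add_distrib]
  refine Finset.sum_le_sum fun n hn => ?_
  have h := mul_le_mul_of_nonneg_right (quadCoeff_le ℓ (Finset.mem_range.1 hn))
    (sq_nonneg (coord θ n))
  have h' : (0 : ℝ) ≤ L * (coord θ n + targetCoeff ℓ L ξ n) ^ 2 := by positivity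
  nlinarith

end Lyapunov

theorem sum_layer_sq_le (ℓ : ℕ → ℕ) {L k : ℕ} (hk : k < L)
    (θ : EuclideanSpace ℝ (Fin (paramCount ℓ L))) :
    (∑ i, (bias ℓ θ (k + 1) i ^ 2 + ∑ j, weight ℓ θ (k + 1) i j ^ 2)) ≤ ‖θ‖ ^ 2 := by
  rw [norm_sq_eq_sum_coord, sum_range_paramCount]
  refine le_trans (le_of_eq ?_) (Finset.single_le_sum (f := fun k =>
    ((∑ i : Fin (ℓ (k + 1)), ∑ j : Fin (ℓ k), coord θ (i * ℓ k + j + paramCount ℓ k) ^ 2) +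
          ∑ i : Fin (ℓ (k + 1)), coord θ (ℓ (k + 1) * ℓ k + i + paramCount ℓ k) ^ 2))
      (fun k _ => by positivity) (Finset.mem_range.2 hk))
  rw [Finset.sum_add_distrib, add_comm]
  rfl

/-! ### Generalized directional derivatives and Euler's identity -/

section Network

variable (ℓ : ℕ → ℕ) {d : ℕ}

/-- The input of the affine map of layer `k + 1`. -/
noncomputable def layerInput (σ : ℕ → ℝ → ℝ) (θ : EuclideanSpace ℝ (Fin d)) :
    (k : ℕ) → EuclideanSpace ℝ (Fin (ℓ 0)) → EuclideanSpace ℝ (Fin (ℓ k))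
  | 0, x => x
  | k + 1, x => WithLp.toLp 2 fun i => σ (k + 1) (realization ℓ σ θ (k + 1) x i)

theorem realization_succ (σ : ℕ → ℝ → ℝ) (θ : EuclideanSpace ℝ (Fin d)) (k : ℕ)
    (x : EuclideanSpace ℝ (Fin (ℓ 0))) :
    realization ℓ σ θ (k + 1) x = affine ℓ θ (k + 1) (layerInput ℓ σ θ k x) := by
  cases k <;> rfl

theorem realization_succ_apply (σ : ℕ → ℝ → ℝ) (θ : EuclideanSpace ℝ (Fin d)) (k : ℕ)
    (x : EuclideanSpace ℝ (Fin (ℓ 0))) (i : Fin (ℓ (k + 1))) :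
    realization ℓ σ θ (k + 1) x i = bias ℓ θ (k + 1) i +
      ∑ j : Fin (ℓ k), weight ℓ θ (k + 1) i j * layerInput ℓ σ θ k x j := by
  rw [realization_succ]; rfl

theorem layerInput_succ_apply (σ : ℕ → ℝ → ℝ) (θ : EuclideanSpace ℝ (Fin d)) (k : ℕ)
    (x : EuclideanSpace ℝ (Fin (ℓ 0))) (i : Fin (ℓ (k + 1))) :
    layerInput ℓ σ θ (k + 1) x i = σ (k + 1) (realization ℓ σ θ (k + 1) x i) := rfl

/-- One step of forward differentiation in the direction `h`, through the affine map of layer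
`k + 1`, given the derivative `v` of the input of this layer. -/
noncomputable def affineTangent (θ h : EuclideanSpace ℝ (Fin d)) (k : ℕ)
    (x v : EuclideanSpace ℝ (Fin (ℓ k))) : EuclideanSpace ℝ (Fin (ℓ (k + 1))) :=
  WithLp.toLp 2 fun i => affine ℓ h (k + 1) x i + ∑ j, weight ℓ θ (k + 1) i j * v j

/-- The generalized directional derivative of `layerInput ℓ relu θ k x` in the direction `h`. -/
noncomputable def tangentInput (θ h : EuclideanSpace ℝ (Fin d)) :
    (k : ℕ) → EuclideanSpace ℝ (Fin (ℓ 0)) → EuclideanSpace ℝ (Fin (ℓ k))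
  | 0, _ => 0
  | k + 1, x => WithLp.toLp 2 fun i =>
      if 0 < realization ℓ relu θ (k + 1) x i then
        affineTangent ℓ θ h k (layerInput ℓ relu θ k x) (tangentInput θ h k x) i else 0

/-- The generalized directional derivative of `realization ℓ relu θ (k + 1) x` in the
direction `h`. -/
noncomputable def tangent (θ h : EuclideanSpace ℝ (Fin d)) (k : ℕ)
    (x : EuclideanSpace ℝ (Fin (ℓ 0))) : EuclideanSpace ℝ (Fin (ℓ (k + 1))) :=
  affineTangent ℓ θ h k (layerInput ℓ relu θ k x) (tangentInput ℓ θ h k x)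

theorem tangentInput_succ_apply (θ h : EuclideanSpace ℝ (Fin d)) (k : ℕ)
    (x : EuclideanSpace ℝ (Fin (ℓ 0))) (i : Fin (ℓ (k + 1))) :
    tangentInput ℓ θ h (k + 1) x i =
      if 0 < realization ℓ relu θ (k + 1) x i then tangent ℓ θ h k x i else 0 := rfl

theorem tangent_apply (θ h : EuclideanSpace ℝ (Fin d)) (k : ℕ)
    (x : EuclideanSpace ℝ (Fin (ℓ 0))) (i : Fin (ℓ (k + 1))) :
    tangent ℓ θ h k x i = bias ℓ h (k + 1) i +
      ∑ j : Fin (ℓ k), weight ℓ h (k + 1) i j * layerInput ℓ relu θ k x j +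
      ∑ j : Fin (ℓ k), weight ℓ θ (k + 1) i j * tangentInput ℓ θ h k x j := rfl

/-- Euler's identity for the scaling of the biases of layer `k` by `λ ^ k` and of all weights
by `λ`, with an additional shift of the biases of the last layer. -/
theorem tangent_eq_of_scaling (θ h : EuclideanSpace ℝ (Fin d)) {K : ℕ}
    (x : EuclideanSpace ℝ (Fin (ℓ 0))) (c : (k : ℕ) → Fin (ℓ (k + 1)) → ℝ)
    (hc : ∀ k < K, ∀ i, c k i = 0)
    (hw : ∀ k ≤ K, ∀ i j, weight ℓ h (k + 1) i j = weight ℓ θ (k + 1) i j)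
    (hb : ∀ k ≤ K, ∀ i, bias ℓ h (k + 1) i = (k + 1) * (bias ℓ θ (k + 1) i - c k i))
    {k : ℕ} (hk : k ≤ K) (i : Fin (ℓ (k + 1))) :
    tangent ℓ θ h k x i = (k + 1) * (realization ℓ relu θ (k + 1) x i - c k i) := by
  induction k with
  | zero =>
    rw [tangent_apply, realization_succ_apply, hb 0 hk]
    simp_rw [hw 0 hk]
    simp [tangentInput]
    ring
  | succ k ih =>
    -- With the value `0` at `0`, the generalized derivative of the rectifier `σ` satisfies `σ' y *
    -- y = σ y` everywhere, so the factor `k + 1` passes through the activation. Hidden layers carry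
    -- no shift.
    have h1 : ∀ j, tangentInput ℓ θ h (k + 1) x j = (k + 1) * layerInput ℓ relu θ (k + 1) x j := by
      intro j
      rw [tangentInput_succ_apply, ih (by omega), layerInput_succ_apply, hc k (by omega), relu]
      split_ifs with hpos
      · rw [max_eq_left hpos.le, sub_zero]
      · rw [max_eq_right (not_lt.1 hpos), mul_zero]
    rw [tangent_apply, realization_succ_apply, hb (k + 1) hk]
    simp_rw [hw (k + 1) hk, h1]
    have h2 : ∑ j : Fin (ℓ (k + 1)),
          weight ℓ θ (k + 1 + 1) i j * ((k + 1) * layerInput ℓ relu θ (k + 1) x j) =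
        (k + 1) * ∑ j : Fin (ℓ (k + 1)),
          weight ℓ θ (k + 1 + 1) i j * layerInput ℓ relu θ (k + 1) x j := by
      rw [Finset.mul_sum]
      exact Finset.sum_congr rfl fun j _ => by ring
    rw [h2]
    push_cast
    ring

end Network

/-- This identity explains the form of `V`: the factor `k` at the biases makes half its gradient the
Euler direction, and the linear term `-2 L ⟨ξ, b^L⟩` turns the output into the error. -/
theorem tangent_lyapunovDir (ℓ : ℕ → ℕ) {K : ℕ} (ξ : EuclideanSpace ℝ (Fin (ℓ (K + 1))))
    (θ : EuclideanSpace ℝ (Fin (paramCount ℓ (K + 1)))) (x : EuclideanSpace ℝ (Fin (ℓ 0))) :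
    tangent ℓ θ (lyapunovDir ℓ ξ θ) K x =
      ((K : ℝ) + 1) • (realization ℓ relu θ (K + 1) x - ξ) := by
  ext i
  rw [tangent_eq_of_scaling ℓ θ (lyapunovDir ℓ ξ θ) (K := K) x
    (fun k i => if k + 1 = K + 1 then coord ξ i else 0)
    (fun k hk i => if_neg (by omega))
    (fun k hk i j => weight_lyapunovDir ℓ ξ θ (by omega) i j)
    (fun k hk i => bias_lyapunovDir ℓ ξ θ (by omega) i) le_rfl i]
  simp

/-- The rectifier approximations eventually agree with the rectifier function at any given point,
and so do their derivatives, with the derivative `0` of the rectifier function at `0`. -/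
theorem IsRectifierApprox.eventually_eq {A B : ℝ} {R : ℝ → ℝ → ℝ} (hR : IsRectifierApprox A B R)
    (hA : 0 < A) (y : ℝ) :
    ∀ᶠ r in atTop, R r y = max y 0 ∧ HasDerivAt (R r) (if 0 < y then 1 else 0) y := by
  have hB : Tendsto (fun r : ℝ => B * r⁻¹) atTop (𝓝 0) := by
    simpa using tendsto_inv_atTop_zero.const_mul B
  by_cases hy : 0 < y
  · filter_upwards [hB.eventually_lt_const hy, eventually_ge_atTop 1] with r hr h1
    refine ⟨by rw [hR.eq_self r h1 y hr.le, max_eq_left hy.le], ?_⟩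
    rw [if_pos hy]
    refine (hasDerivAt_id y).congr_of_eventuallyEq ?_
    filter_upwards [lt_mem_nhds hr] with z hz using hR.eq_self r h1 z hz.le
  · rw [not_lt] at hy
    filter_upwards [eventually_ge_atTop 1] with r h1
    -- Because `A > 0`, `R r` vanishes near `y` even for `y = 0`; this fixes the derivative `0`
    -- there.
    have hr : y < A * r⁻¹ := lt_of_le_of_lt hy (by positivity)
    refine ⟨by rw [hR.eq_zero r h1 y hr.le, max_eq_right hy], ?_⟩
    rw [if_neg (not_lt.2 hy)]
    refine (hasDerivAt_const y (0 : ℝ)).congr_of_eventuallyEq ?_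
    filter_upwards [gt_mem_nhds hr] with z hz using hR.eq_zero r h1 z hz.le

theorem approxAct_eventually_eq {A B : ℝ} {R : ℝ → ℝ → ℝ} (hR : IsRectifierApprox A B R)
    (hA : 0 < A) (k : ℕ) (y : ℝ) :
    ∀ᶠ r in atTop, approxAct R r (k + 1) y = max y 0 ∧
      HasDerivAt (approxAct R r (k + 1)) (if 0 < y then 1 else 0) y :=
  (tendsto_rpow_atTop (y := 1 / ((k + 1 : ℕ) : ℝ)) (by positivity)).eventually
    (hR.eventually_eq hA y)

/-! ### Differentiating the approximating networks for large `r` -/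

section Differentiation

variable (ℓ : ℕ → ℕ) {d : ℕ} {A B : ℝ} {R : ℝ → ℝ → ℝ}

/-- If the input of layer `k + 1` is differentiable with respect to the parameters, then so is its
output. -/
theorem hasFDerivAt_realization_succ {σ : ℕ → ℝ → ℝ} {θ : EuclideanSpace ℝ (Fin d)} {k : ℕ}
    {x : EuclideanSpace ℝ (Fin (ℓ 0))}
    (hv : ∀ j, layerInput ℓ σ θ k x j = layerInput ℓ relu θ k x j)
    (hd : ∀ j, ∃ D : EuclideanSpace ℝ (Fin d) →L[ℝ] ℝ,
      HasFDerivAt (fun θ' => layerInput ℓ σ θ' k x j) D θ ∧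
        ∀ h, D h = tangentInput ℓ θ h k x j) (i : Fin (ℓ (k + 1))) :
    ∃ D : EuclideanSpace ℝ (Fin d) →L[ℝ] ℝ,
      HasFDerivAt (fun θ' => realization ℓ σ θ' (k + 1) x i) D θ ∧
        ∀ h, D h = tangent ℓ θ h k x i := by
  choose D hD hDh using hd
  obtain ⟨β, hβ⟩ := exists_coord_clm d (ℓ (k + 1) * ℓ k + i + paramCount ℓ k)
  choose ω hω using fun j : Fin (ℓ k) => exists_coord_clm d (i * ℓ k + j + paramCount ℓ k)
  have hb : HasFDerivAt (fun θ' : EuclideanSpace ℝ (Fin d) => bias ℓ θ' (k + 1) i) β θ :=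
    β.hasFDerivAt.congr_of_eventuallyEq (Eventually.of_forall fun θ' => (hβ θ').symm)
  have hw : ∀ j, HasFDerivAt
      (fun θ' : EuclideanSpace ℝ (Fin d) => weight ℓ θ' (k + 1) i j) (ω j) θ := fun j =>
    (ω j).hasFDerivAt.congr_of_eventuallyEq (Eventually.of_forall fun θ' => (hω j θ').symm)
  refine ⟨_, (hb.add (HasFDerivAt.fun_sum (u := Finset.univ)
    fun j _ => (hw j).mul (hD j))).congr_of_eventuallyEq
      (Eventually.of_forall fun θ' => realization_succ_apply ℓ σ θ' k x i), fun h => ?_⟩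
  rw [tangent_apply, add_assoc, ← Finset.sum_add_distrib]
  simp only [add_apply, sum_apply,
    smul_apply, smul_eq_mul, hDh, hω, hβ, hv]
  congr 1
  refine Finset.sum_congr rfl fun j _ => ?_
  rw [add_comm, mul_comm (layerInput ℓ relu θ k x j)]
  rfl

/-- For any given parameters and input and sufficiently large `r`, the approximating network
agrees with the ReLU network, and its derivative agrees with the generalized derivative. -/
theorem eventually_layerInput (hR : IsRectifierApprox A B R) (hA : 0 < A)
    (θ : EuclideanSpace ℝ (Fin d)) (k : ℕ) (x : EuclideanSpace ℝ (Fin (ℓ 0))) :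
    ∀ᶠ r in atTop, ∀ i, layerInput ℓ (approxAct R r) θ k x i = layerInput ℓ relu θ k x i ∧
      ∃ D : EuclideanSpace ℝ (Fin d) →L[ℝ] ℝ,
        HasFDerivAt (fun θ' => layerInput ℓ (approxAct R r) θ' k x i) D θ ∧
          ∀ h, D h = tangentInput ℓ θ h k x i := by
  induction k with
  | zero => exact Eventually.of_forall fun r i => ⟨rfl, 0,
      hasFDerivAt_const (x i) θ, fun h => rfl⟩
  | succ k ih =>
    have hact := eventually_all.2 fun i =>
      approxAct_eventually_eq hR hA k (realization ℓ relu θ (k + 1) x i)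
    filter_upwards [ih, hact] with r hr hact i
    obtain ⟨D, hD, hDh⟩ :=
      hasFDerivAt_realization_succ ℓ (fun j => (hr j).1) (fun j => (hr j).2) i
    have heq : realization ℓ (approxAct R r) θ (k + 1) x i = realization ℓ relu θ (k + 1) x i := by
      rw [realization_succ_apply, realization_succ_apply]
      simp_rw [fun j => (hr j).1]
    have hder := (hact i).2
    -- The chain rule needs the derivative of the activation at the output of the approximating
    -- network, which already agrees with the ReLU output.
    rw [← heq] at hder
    refine ⟨by rw [layerInput_succ_apply, heq, (hact i).1]; rfl, _,
      hder.comp_hasFDerivAt θ hD, fun h => ?_⟩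
    rw [tangentInput_succ_apply, smul_apply, hDh, smul_eq_mul, heq]
    split_ifs <;> simp

theorem eventually_realization (hR : IsRectifierApprox A B R) (hA : 0 < A)
    (θ : EuclideanSpace ℝ (Fin d)) (k : ℕ) (x : EuclideanSpace ℝ (Fin (ℓ 0))) :
    ∀ᶠ r in atTop, ∀ i,
      realization ℓ (approxAct R r) θ (k + 1) x i = realization ℓ relu θ (k + 1) x i ∧
      ∃ D : EuclideanSpace ℝ (Fin d) →L[ℝ] ℝ,
        HasFDerivAt (fun θ' => realization ℓ (approxAct R r) θ' (k + 1) x i) D θ ∧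
          ∀ h, D h = tangent ℓ θ h k x i := by
  filter_upwards [eventually_layerInput ℓ hR hA θ k x] with r hr i
  refine ⟨?_, hasFDerivAt_realization_succ ℓ (fun j => (hr j).1) (fun j => (hr j).2) i⟩
  rw [realization_succ_apply, realization_succ_apply]
  simp_rw [fun j => (hr j).1]

end Differentiation

/-- The generalized directional derivative of the empirical risk of the ReLU network. -/
noncomputable def empTangent (ℓ : ℕ → ℕ) (K : ℕ) (ξ : EuclideanSpace ℝ (Fin (ℓ (K + 1))))
    (M : ℕ) (x : ℕ → EuclideanSpace ℝ (Fin (ℓ 0)))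
    (θ h : EuclideanSpace ℝ (Fin (paramCount ℓ (K + 1)))) : ℝ :=
  1 / (M : ℝ) * ∑ m ∈ Finset.Icc 1 M,
    2 * inner ℝ (realization ℓ relu θ (K + 1) (x m) - ξ) (tangent ℓ θ h K (x m))

/-! ### Existence of the limiting gradient -/

section EmpRisk

variable (ℓ : ℕ → ℕ) {K : ℕ} (ξ : EuclideanSpace ℝ (Fin (ℓ (K + 1)))) {A B : ℝ} {R : ℝ → ℝ → ℝ}
  (M : ℕ) (x : ℕ → EuclideanSpace ℝ (Fin (ℓ 0)))
  (θ : EuclideanSpace ℝ (Fin (paramCount ℓ (K + 1))))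

/-- Only finitely many data points enter, so a common threshold for `r` exists. -/
theorem eventually_hasFDerivAt_empRisk (hR : IsRectifierApprox A B R) (hA : 0 < A) :
    ∀ᶠ r in atTop, ∃ D : EuclideanSpace ℝ (Fin (paramCount ℓ (K + 1))) →L[ℝ] ℝ,
      HasFDerivAt (empRisk ℓ (K + 1) ξ (approxAct R r) M x) D θ ∧
        ∀ h, D h = empTangent ℓ K ξ M x θ h := by
  have hall := (Finset.eventually_all (Finset.Icc 1 M)).2 fun m _ =>
    eventually_realization ℓ hR hA θ K (x m)
  filter_upwards [hall] with r hr
  have hm : ∀ m ∈ Finset.Icc 1 M, ∃ D : EuclideanSpace ℝ (Fin (paramCount ℓ (K + 1))) →L[ℝ] ℝ,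
      HasFDerivAt (fun θ' => ‖realization ℓ (approxAct R r) θ' (K + 1) (x m) - ξ‖ ^ 2) D θ ∧
        ∀ h, D h =
          2 * inner ℝ (realization ℓ relu θ (K + 1) (x m) - ξ) (tangent ℓ θ h K (x m)) := by
    intro m hmem
    choose hv D hD hDh using hr m hmem
    refine ⟨_, (HasFDerivAt.fun_sum (u := Finset.univ) fun i _ =>
      ((hD i).sub_const (ξ i)).pow 2).congr_of_eventuallyEq
      (Eventually.of_forall fun θ' => ?_), fun h => ?_⟩
    · simp [EuclideanSpace.real_norm_sq_eq]
    · rw [PiLp.inner_apply, Finset.mul_sum]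
      simp only [sum_apply, smul_apply, smul_eq_mul, hDh,
        hv]
      refine Finset.sum_congr rfl fun i _ => ?_
      simp
      ring
  choose! D hD hDh using hm
  refine ⟨_, (HasFDerivAt.fun_sum fun m hm => hD m hm).const_mul (1 / (M : ℝ)), fun h => ?_⟩
  simp only [sum_apply, smul_apply, smul_eq_mul,
    empTangent]
  rw [Finset.sum_congr rfl fun m hm => hDh m hm h]

/-- The gradients of the empirical risks of the approximating networks converge, and their limit
represents the generalized directional derivative. -/
theorem exists_tendsto_gradient_empRisk (hR : IsRectifierApprox A B R) (hA : 0 < A) :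
    ∃ g, Tendsto (fun r : ℝ => gradient (empRisk ℓ (K + 1) ξ (approxAct R r) M x) θ) atTop
      (𝓝 g) ∧ ∀ h, inner ℝ g h = empTangent ℓ K ξ M x θ h := by
  have hev := eventually_hasFDerivAt_empRisk ℓ ξ M x θ hR hA
  obtain ⟨r₀, D₀, -, hD₀⟩ := hev.exists
  refine ⟨(InnerProductSpace.toDual ℝ _).symm D₀, ?_, fun h => ?_⟩
  -- The gradients are eventually constant in `r`: all the derivatives equal the functional
  -- `empTangent`, which does not involve `r`.
  · refine tendsto_const_nhds.congr' ?_
    filter_upwards [hev] with r ⟨D, hD, hDh⟩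
    rw [gradient, hD.fderiv]
    congr 1
    ext1 h
    rw [hDh, hD₀]
  · rw [InnerProductSpace.toDual_symm_apply, hD₀]

end EmpRisk

theorem norm_le_norm_of_abs_le {n : ℕ} {u v : EuclideanSpace ℝ (Fin n)}
    (h : ∀ i, |u i| ≤ |v i|) : ‖u‖ ≤ ‖v‖ := by
  refine le_of_sq_le_sq ?_ (norm_nonneg _)
  rw [EuclideanSpace.real_norm_sq_eq, EuclideanSpace.real_norm_sq_eq]
  exact Finset.sum_le_sum fun i _ => sq_le_sq.2 (h i)

/-! ### Growth and Lipschitz bounds for the network -/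

section Bounds

variable (ℓ : ℕ → ℕ) {L : ℕ}

/-- The linear part of the affine map of layer `k + 1`. -/
noncomputable def weightMul {d : ℕ} (θ : EuclideanSpace ℝ (Fin d)) (k : ℕ)
    (v : EuclideanSpace ℝ (Fin (ℓ k))) : EuclideanSpace ℝ (Fin (ℓ (k + 1))) :=
  WithLp.toLp 2 fun i => ∑ j : Fin (ℓ k), weight ℓ θ (k + 1) i j * v j

theorem affineTangent_eq {d : ℕ} (θ h : EuclideanSpace ℝ (Fin d)) (k : ℕ)
    (x v : EuclideanSpace ℝ (Fin (ℓ k))) :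
    affineTangent ℓ θ h k x v = affine ℓ h (k + 1) x + weightMul ℓ θ k v := rfl

theorem affine_sub_affine {d : ℕ} (θ θ' : EuclideanSpace ℝ (Fin d)) (k : ℕ)
    (v v' : EuclideanSpace ℝ (Fin (ℓ k))) :
    affine ℓ θ (k + 1) v - affine ℓ θ' (k + 1) v' =
      affine ℓ (θ - θ') (k + 1) v + weightMul ℓ θ' k (v - v') := by
  ext i
  have h : ∀ j : Fin (ℓ k), weight ℓ θ (k + 1) i j * v j - weight ℓ θ' (k + 1) i j * v' j =
      weight ℓ (θ - θ') (k + 1) i j * v j + weight ℓ θ' (k + 1) i j * (v j - v' j) := fun j => by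
    simp only [weight, coord_sub]; ring
  change bias ℓ θ (k + 1) i + ∑ j : Fin (ℓ k), weight ℓ θ (k + 1) i j * v j -
    (bias ℓ θ' (k + 1) i + ∑ j : Fin (ℓ k), weight ℓ θ' (k + 1) i j * v' j) =
    bias ℓ (θ - θ') (k + 1) i + ∑ j : Fin (ℓ k), weight ℓ (θ - θ') (k + 1) i j * v j +
      ∑ j : Fin (ℓ k), weight ℓ θ' (k + 1) i j * (v j - v' j)
  rw [add_assoc, ← Finset.sum_add_distrib, ← Finset.sum_congr rfl fun j _ => h j,
    Finset.sum_sub_distrib]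
  simp only [bias, coord_sub]
  ring

variable (θ : EuclideanSpace ℝ (Fin (paramCount ℓ L))) {k : ℕ}

theorem norm_weightMul_le (hk : k < L) (v : EuclideanSpace ℝ (Fin (ℓ k))) :
    ‖weightMul ℓ θ k v‖ ≤ ‖θ‖ * ‖v‖ := by
  refine le_of_sq_le_sq ?_ (by positivity)
  rw [mul_pow, EuclideanSpace.real_norm_sq_eq]
  refine le_trans ?_ (mul_le_mul_of_nonneg_right (sum_layer_sq_le ℓ hk θ) (sq_nonneg _))
  rw [Finset.sum_mul]
  refine Finset.sum_le_sum fun i _ => ?_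
  have h : (∑ j : Fin (ℓ k), weight ℓ θ (k + 1) i j * v j) ^ 2 ≤
      (∑ j : Fin (ℓ k), weight ℓ θ (k + 1) i j ^ 2) * ∑ j, v j ^ 2 :=
    Finset.sum_mul_sq_le_sq_mul_sq _ _ _
  rw [← EuclideanSpace.real_norm_sq_eq] at h
  refine h.trans (mul_le_mul_of_nonneg_right ?_ (sq_nonneg _))
  exact le_add_of_nonneg_left (sq_nonneg _)

/-- Cauchy–Schwarz with the bias regarded as the weight of an additional input equal to `1`. -/
theorem norm_affine_le (hk : k < L) (v : EuclideanSpace ℝ (Fin (ℓ k))) :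
    ‖affine ℓ θ (k + 1) v‖ ≤ ‖θ‖ * √(‖v‖ ^ 2 + 1) := by
  refine le_of_sq_le_sq ?_ (by positivity)
  rw [mul_pow, Real.sq_sqrt (by positivity), EuclideanSpace.real_norm_sq_eq]
  refine le_trans ?_ (mul_le_mul_of_nonneg_right (sum_layer_sq_le ℓ hk θ) (by positivity))
  rw [Finset.sum_mul]
  refine Finset.sum_le_sum fun i _ => ?_
  have h : (∑ j : Fin (ℓ k), weight ℓ θ (k + 1) i j * v j) ^ 2 ≤
      (∑ j : Fin (ℓ k), weight ℓ θ (k + 1) i j ^ 2) * ∑ j, v j ^ 2 :=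
    Finset.sum_mul_sq_le_sq_mul_sq _ _ _
  rw [← EuclideanSpace.real_norm_sq_eq] at h
  change (bias ℓ θ (k + 1) i + ∑ j : Fin (ℓ k), weight ℓ θ (k + 1) i j * v j) ^ 2 ≤
    (bias ℓ θ (k + 1) i ^ 2 + ∑ j : Fin (ℓ k), weight ℓ θ (k + 1) i j ^ 2) * (‖v‖ ^ 2 + 1)
  set W := ∑ j : Fin (ℓ k), weight ℓ θ (k + 1) i j ^ 2
  have hW : 0 ≤ W := Finset.sum_nonneg fun _ _ => sq_nonneg _
  set u := ∑ j : Fin (ℓ k), weight ℓ θ (k + 1) i j * v j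
  set β := bias ℓ θ (k + 1) i
  -- Since `u ^ 2 ≤ W * ‖v‖ ^ 2`, this is the arithmetic-geometric mean inequality for `β ^ 2 * ‖v‖
  -- ^ 2` and `W`.
  have hcross : 2 * (β * u) ≤ β ^ 2 * ‖v‖ ^ 2 + W := by
    refine le_of_sq_le_sq ?_ (by positivity)
    nlinarith [mul_le_mul_of_nonneg_left h (sq_nonneg β), sq_nonneg (β ^ 2 * ‖v‖ ^ 2 - W)]
  nlinarith

theorem norm_layerInput_succ_le {d : ℕ} (θ : EuclideanSpace ℝ (Fin d)) (k : ℕ)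
    (x : EuclideanSpace ℝ (Fin (ℓ 0))) :
    ‖layerInput ℓ relu θ (k + 1) x‖ ≤ ‖realization ℓ relu θ (k + 1) x‖ := by
  refine norm_le_norm_of_abs_le fun i => ?_
  rw [layerInput_succ_apply, relu, abs_of_nonneg (le_max_right _ _)]
  exact max_le (le_abs_self _) (abs_nonneg _)

theorem norm_tangentInput_succ_le {d : ℕ} (θ h : EuclideanSpace ℝ (Fin d)) (k : ℕ)
    (x : EuclideanSpace ℝ (Fin (ℓ 0))) :
    ‖tangentInput ℓ θ h (k + 1) x‖ ≤ ‖tangent ℓ θ h k x‖ := by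
  refine norm_le_norm_of_abs_le fun i => ?_
  rw [tangentInput_succ_apply]
  split_ifs <;> simp

/-- The summand `1` makes the layer bound multiplicative: `‖θ‖ ^ 2 * (t ^ 2 + 1) + 1 ≤ (‖θ‖ ^ 2 + 1)
* (t ^ 2 + 1)`. -/
theorem sqrt_norm_layerInput_le (hk : k ≤ L) (x : EuclideanSpace ℝ (Fin (ℓ 0))) :
    √(‖layerInput ℓ relu θ k x‖ ^ 2 + 1) ≤ √(‖θ‖ ^ 2 + 1) ^ k * √(‖x‖ ^ 2 + 1) := by
  induction k with
  | zero => simp [layerInput]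
  | succ k ih =>
    have h1 := (norm_layerInput_succ_le ℓ θ k x).trans
      ((realization_succ ℓ relu θ k x).symm ▸ norm_affine_le ℓ θ hk (layerInput ℓ relu θ k x))
    have h2 : √(‖layerInput ℓ relu θ (k + 1) x‖ ^ 2 + 1) ≤
        √(‖θ‖ ^ 2 + 1) * √(‖layerInput ℓ relu θ k x‖ ^ 2 + 1) := by
      rw [← Real.sqrt_mul (by positivity)]
      refine Real.sqrt_le_sqrt ?_
      have h3 := pow_le_pow_left₀ (norm_nonneg _) h1 2
      rw [mul_pow, Real.sq_sqrt (by positivity)] at h3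
      nlinarith [sq_nonneg ‖layerInput ℓ relu θ k x‖]
    calc _ ≤ _ := h2
      _ ≤ √(‖θ‖ ^ 2 + 1) * (√(‖θ‖ ^ 2 + 1) ^ k * √(‖x‖ ^ 2 + 1)) := by
        gcongr; exact ih (by omega)
      _ = _ := by ring

/-- Perturbing the parameters of any one of the `k + 1` layers contributes the same bound: each
other layer costs a factor of at most `√(‖θ‖ ^ 2 + 1)`, and activations do not increase norms. -/
theorem norm_tangent_le (h : EuclideanSpace ℝ (Fin (paramCount ℓ L))) (hk : k < L)
    (x : EuclideanSpace ℝ (Fin (ℓ 0))) :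
    ‖tangent ℓ θ h k x‖ ≤ (k + 1) * √(‖θ‖ ^ 2 + 1) ^ k * √(‖x‖ ^ 2 + 1) * ‖h‖ := by
  have hθ : ‖θ‖ ≤ √(‖θ‖ ^ 2 + 1) := Real.le_sqrt_of_sq_le (by linarith)
  have hstep : ∀ k < L, ‖tangent ℓ θ h k x‖ ≤
      √(‖θ‖ ^ 2 + 1) ^ k * √(‖x‖ ^ 2 + 1) * ‖h‖ +
        √(‖θ‖ ^ 2 + 1) * ‖tangentInput ℓ θ h k x‖ := by
    intro k hk
    rw [tangent, affineTangent_eq]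
    refine (norm_add_le _ _).trans (add_le_add ?_ ?_)
    · refine (norm_affine_le ℓ h hk _).trans ?_
      rw [mul_comm]
      gcongr
      exact sqrt_norm_layerInput_le ℓ θ hk.le x
    · refine (norm_weightMul_le ℓ θ hk _).trans ?_
      gcongr
  induction k with
  | zero =>
    refine (hstep 0 hk).trans ?_
    simp [tangentInput]
  | succ k ih =>
    refine (hstep _ hk).trans ?_
    have h1 := mul_le_mul_of_nonneg_left ((norm_tangentInput_succ_le ℓ θ h k x).trans
      (ih (by omega))) (Real.sqrt_nonneg (‖θ‖ ^ 2 + 1))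
    refine (add_le_add_right h1 _).trans (le_of_eq ?_)
    push_cast
    ring

/-- On bounded sets, the ReLU network is bounded and Lipschitz continuous in its parameters,
uniformly in the input. -/
theorem exists_layerInput_lipschitz (ρ D : ℝ) (k : ℕ) (hk : k ≤ L) :
    ∃ C : ℝ, 0 ≤ C ∧ ∀ θ θ' : EuclideanSpace ℝ (Fin (paramCount ℓ L)), ‖θ‖ ≤ ρ → ‖θ'‖ ≤ ρ →
      ∀ x : EuclideanSpace ℝ (Fin (ℓ 0)), ‖x‖ ≤ D → ‖realization ℓ relu θ k x‖ ≤ C ∧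
        ‖layerInput ℓ relu θ k x‖ ≤ C ∧
        ‖realization ℓ relu θ k x - realization ℓ relu θ' k x‖ ≤ C * ‖θ - θ'‖ ∧
        ‖layerInput ℓ relu θ k x - layerInput ℓ relu θ' k x‖ ≤ C * ‖θ - θ'‖ := by
  induction k with
  | zero =>
    refine ⟨|D|, abs_nonneg D, fun θ θ' _ _ x hx => ?_⟩
    have hx' := hx.trans (le_abs_self D)
    have h0 : 0 ≤ |D| * ‖θ - θ'‖ := by positivity
    simpa [realization, layerInput] using ⟨hx', h0⟩
  | succ k ih =>
    obtain ⟨C, hC, h⟩ := ih (by omega)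
    -- The first summand bounds the output; the bracket is its Lipschitz constant.
    refine ⟨|ρ| * √(C ^ 2 + 1) + (√(C ^ 2 + 1) + |ρ| * C), by positivity,
      fun θ θ' hθ hθ' x hx => ?_⟩
    obtain ⟨-, h1, -, h2⟩ := h θ θ' hθ hθ' x hx
    have hsq : √(‖layerInput ℓ relu θ k x‖ ^ 2 + 1) ≤ √(C ^ 2 + 1) := by gcongr
    have h3 : ‖realization ℓ relu θ (k + 1) x‖ ≤
        |ρ| * √(C ^ 2 + 1) + (√(C ^ 2 + 1) + |ρ| * C) := by
      rw [realization_succ]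
      refine (norm_affine_le ℓ θ hk _).trans ?_
      refine (mul_le_mul (hθ.trans (le_abs_self ρ)) hsq (by positivity) (by positivity)).trans ?_
      exact le_add_of_nonneg_right (by positivity)
    have h4 : ‖realization ℓ relu θ (k + 1) x - realization ℓ relu θ' (k + 1) x‖ ≤
        (|ρ| * √(C ^ 2 + 1) + (√(C ^ 2 + 1) + |ρ| * C)) * ‖θ - θ'‖ := by
      rw [realization_succ, realization_succ, affine_sub_affine]
      have h5 := norm_affine_le ℓ (θ - θ') hk (layerInput ℓ relu θ k x)
      have h6 := norm_weightMul_le ℓ θ' hk (layerInput ℓ relu θ k x - layerInput ℓ relu θ' k x)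
      have h7 := mul_le_mul_of_nonneg_left hsq (norm_nonneg (θ - θ'))
      have h8 := mul_le_mul (hθ'.trans (le_abs_self ρ)) h2 (by positivity) (by positivity)
      have h9 : 0 ≤ |ρ| * √(C ^ 2 + 1) * ‖θ - θ'‖ := by positivity
      refine (norm_add_le _ _).trans ?_
      nlinarith
    refine ⟨h3, (norm_layerInput_succ_le ℓ θ k x).trans h3, h4, le_trans ?_ h4⟩
    refine norm_le_norm_of_abs_le fun i => ?_
    rw [PiLp.sub_apply, PiLp.sub_apply, layerInput_succ_apply, layerInput_succ_apply]
    exact abs_max_sub_max_le_abs _ _ _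

end Bounds

/-! ### Joint measurability in parameters and data -/

section Measurability

variable (ℓ : ℕ → ℕ) {d : ℕ} {α : Type*} {mα : MeasurableSpace α}
  {θ : α → EuclideanSpace ℝ (Fin d)} {x : α → EuclideanSpace ℝ (Fin (ℓ 0))}

theorem measurable_coord (hθ : Measurable θ) (n : ℕ) : Measurable fun a => coord (θ a) n := by
  obtain ⟨D, hD⟩ := exists_coord_clm d n
  simp_rw [← hD]
  exact D.measurable.comp hθ

theorem measurable_layerInput (hθ : Measurable θ) (hx : Measurable x) (k : ℕ) (i : Fin (ℓ k)) :
    Measurable fun a => layerInput ℓ relu (θ a) k (x a) i := by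
  induction k with
  | zero => exact (EuclideanSpace.proj (𝕜 := ℝ) i).measurable.comp hx
  | succ k ih =>
    simp_rw [layerInput_succ_apply, realization_succ_apply]
    refine Measurable.max (Measurable.add (measurable_coord hθ _) ?_) measurable_const
    exact Finset.measurable_sum _ fun j _ => (measurable_coord hθ _).mul (ih j)

theorem measurable_realization (hθ : Measurable θ) (hx : Measurable x) (k : ℕ)
    (i : Fin (ℓ (k + 1))) : Measurable fun a => realization ℓ relu (θ a) (k + 1) (x a) i := by
  simp_rw [realization_succ_apply]
  refine Measurable.add (measurable_coord hθ _) ?_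
  exact Finset.measurable_sum _ fun j _ =>
    (measurable_coord hθ _).mul (measurable_layerInput ℓ hθ hx k j)

theorem measurable_tangentInput (hθ : Measurable θ) (hx : Measurable x)
    (h : EuclideanSpace ℝ (Fin d)) (k : ℕ) (i : Fin (ℓ k)) :
    Measurable fun a => tangentInput ℓ (θ a) h k (x a) i := by
  induction k with
  | zero => exact measurable_const
  | succ k ih =>
    simp_rw [tangentInput_succ_apply, tangent_apply]
    refine Measurable.ite (measurableSet_lt measurable_const
      (measurable_realization ℓ hθ hx k i)) ?_ measurable_const
    refine (measurable_const.add (Finset.measurable_sum _ fun j _ => ?_)).add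
      (Finset.measurable_sum _ fun j _ => (measurable_coord hθ _).mul (ih j))
    exact measurable_const.mul (measurable_layerInput ℓ hθ hx k j)

theorem measurable_tangent (hθ : Measurable θ) (hx : Measurable x)
    (h : EuclideanSpace ℝ (Fin d)) (k : ℕ) (i : Fin (ℓ (k + 1))) :
    Measurable fun a => tangent ℓ (θ a) h k (x a) i := by
  simp_rw [tangent_apply]
  refine (measurable_const.add (Finset.measurable_sum _ fun j _ => ?_)).add
    (Finset.measurable_sum _ fun j _ => (measurable_coord hθ _).mul
      (measurable_tangentInput ℓ hθ hx h k j))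
  exact measurable_const.mul (measurable_layerInput ℓ hθ hx k j)

theorem measurable_sqLoss (hθ : Measurable θ) (hx : Measurable x) (k : ℕ)
    (ξ : EuclideanSpace ℝ (Fin (ℓ (k + 1)))) :
    Measurable fun a => ‖realization ℓ relu (θ a) (k + 1) (x a) - ξ‖ ^ 2 := by
  simp_rw [EuclideanSpace.real_norm_sq_eq]
  exact Finset.measurable_sum _ fun i _ =>
    ((measurable_realization ℓ hθ hx k i).sub measurable_const).pow_const 2

end Measurability

/-! ### Descent of the Lyapunov function in one gradient step -/

section Descent

variable (ℓ : ℕ → ℕ) {K : ℕ} (ξ : EuclideanSpace ℝ (Fin (ℓ (K + 1))))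

/-- The coordinates of `g` are generalized derivatives along basis vectors, and these are given by
explicit measurable recursions. -/
theorem measurable_of_inner_eq_empTangent {α : Type*} {mα : MeasurableSpace α} (M : ℕ)
    {x : α → ℕ → EuclideanSpace ℝ (Fin (ℓ 0))}
    {θ g : α → EuclideanSpace ℝ (Fin (paramCount ℓ (K + 1)))}
    (hg : ∀ a h, inner ℝ (g a) h = empTangent ℓ K ξ M (x a) (θ a) h)
    (hθ : Measurable θ) (hx : ∀ m, Measurable fun a => x a m) : Measurable g := by
  have hcoord : ∀ i, Measurable fun a => g a i := by
    intro i
    have : (fun a => g a i) = fun a =>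
        empTangent ℓ K ξ M (x a) (θ a) (EuclideanSpace.single i 1) := by
      funext a
      rw [← hg, real_inner_comm, EuclideanSpace.inner_single_left]
      simp
    rw [this]
    refine measurable_const.mul (Finset.measurable_sum _ fun m _ => measurable_const.mul ?_)
    simp only [PiLp.inner_apply]
    refine Finset.measurable_sum _ fun i _ => ?_
    have h1 := (measurable_realization ℓ hθ (hx m) K i).sub (measurable_const (a := ξ i))
    exact (measurable_tangent ℓ hθ (hx m) _ K i).mul h1
  exact (WithLp.measurable_toLp 2 _).comp (measurable_pi_lambda _ hcoord)

variable {M : ℕ} (hM : 1 ≤ M) {x : ℕ → EuclideanSpace ℝ (Fin (ℓ 0))}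
  {θ g : EuclideanSpace ℝ (Fin (paramCount ℓ (K + 1)))}
  (hg : ∀ h, inner ℝ g h = empTangent ℓ K ξ M x θ h)

theorem empRisk_nonneg (σ : ℕ → ℝ → ℝ) (M : ℕ) (x : ℕ → EuclideanSpace ℝ (Fin (ℓ 0)))
    (θ : EuclideanSpace ℝ (Fin (paramCount ℓ (K + 1)))) : 0 ≤ empRisk ℓ (K + 1) ξ σ M x θ := by
  unfold empRisk; positivity

include hg in
theorem inner_lyapunovDir_eq :
    inner ℝ (lyapunovDir ℓ ξ θ) g = 2 * (K + 1) * empRisk ℓ (K + 1) ξ relu M x θ := by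
  rw [real_inner_comm, hg, empTangent, empRisk, mul_left_comm]
  congr 1
  rw [Finset.mul_sum]
  refine Finset.sum_congr rfl fun m _ => ?_
  rw [tangent_lyapunovDir, inner_smul_right, real_inner_self_eq_norm_sq]
  ring

include hM hg in
-- Testing the gradient against itself writes `‖g‖ ^ 2` as an average of products of errors with
-- derivatives of size at most `Λ * ‖g‖`, so the errors control it.
theorem norm_sq_gradient_le {S : ℝ} (hS : ∀ m, ‖x m‖ ^ 2 + 1 ≤ S) :
    ‖g‖ ^ 2 ≤ 4 * ((K + 1) ^ 2 * (‖θ‖ ^ 2 + 1) ^ K * S) * empRisk ℓ (K + 1) ξ relu M x θ := by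
  have hM' : (0 : ℝ) < M := by exact_mod_cast hM
  have hS0 : 0 ≤ S := le_trans (by positivity) (hS 0)
  set Λ := (K + 1) * √(‖θ‖ ^ 2 + 1) ^ K * √S with hΛ
  have hΛ0 : 0 ≤ Λ := by positivity
  have hΛsq : Λ ^ 2 = (K + 1) ^ 2 * (‖θ‖ ^ 2 + 1) ^ K * S := by
    rw [hΛ, mul_pow, mul_pow, Real.sq_sqrt hS0, ← pow_mul, mul_comm K 2, pow_mul,
      Real.sq_sqrt (by positivity)]
  rw [← hΛsq]
  -- Young's inequality, weighted so that after averaging `‖g‖ ^ 2 / 2` can be absorbed on the left.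
  have hterm : ∀ m ∈ Finset.Icc 1 M,
      2 * inner ℝ (realization ℓ relu θ (K + 1) (x m) - ξ) (tangent ℓ θ g K (x m)) ≤
        2 * Λ ^ 2 * ‖realization ℓ relu θ (K + 1) (x m) - ξ‖ ^ 2 + ‖g‖ ^ 2 / 2 := by
    intro m _
    have h1 := real_inner_le_norm (realization ℓ relu θ (K + 1) (x m) - ξ)
      (tangent ℓ θ g K (x m))
    have h2 : ‖tangent ℓ θ g K (x m)‖ ≤ Λ * ‖g‖ := by
      refine (norm_tangent_le ℓ θ g (Nat.lt_succ_self K) (x m)).trans ?_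
      rw [hΛ]
      gcongr
      exact hS m
    have h3 := mul_le_mul_of_nonneg_left h2
      (norm_nonneg (realization ℓ relu θ (K + 1) (x m) - ξ))
    nlinarith [sq_nonneg (2 * Λ * ‖realization ℓ relu θ (K + 1) (x m) - ξ‖ - ‖g‖)]
  have hsum := mul_le_mul_of_nonneg_left (Finset.sum_le_sum hterm)
    (show (0 : ℝ) ≤ 1 / M by positivity)
  rw [← empTangent, ← hg, real_inner_self_eq_norm_sq, Finset.sum_add_distrib, ← Finset.mul_sum,
    mul_add, mul_left_comm, ← empRisk, Finset.sum_const, Nat.card_Icc, nsmul_eq_mul] at hsum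
  simp only [Nat.add_sub_cancel] at hsum
  rw [← mul_assoc, one_div_mul_cancel hM'.ne', one_mul] at hsum
  linarith

include hM hg in
/-- A gradient step with a small learning rate decreases the Lyapunov function. -/
theorem lyapunov_descent {S γ δ : ℝ} (hS : ∀ m, ‖x m‖ ^ 2 + 1 ≤ S) (hγ : 0 ≤ γ)
    (hδ : γ * ((K + 1) ^ 2 * (‖θ‖ ^ 2 + 1) ^ K * S) ≤ δ) :
    lyapunov ℓ (K + 1) ξ (θ - γ • g) ≤ lyapunov ℓ (K + 1) ξ θ -
      4 * (K + 1) * (1 - δ) * (γ * empRisk ℓ (K + 1) ξ relu M x θ) := by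
  have h1 := lyapunov_step_le ℓ ξ θ (by omega) γ g
  rw [inner_lyapunovDir_eq ℓ ξ hg] at h1
  have h2 := mul_le_mul_of_nonneg_left (norm_sq_gradient_le ℓ ξ hM hg hS)
    (show (0 : ℝ) ≤ γ ^ 2 * (K + 1) by positivity)
  -- The second-order term is at most `δ` times the first-order decrease.
  have h3 := mul_le_mul_of_nonneg_right hδ (show (0 : ℝ) ≤
    4 * (K + 1) * (γ * empRisk ℓ (K + 1) ξ relu M x θ) from
      mul_nonneg (by positivity) (mul_nonneg hγ (empRisk_nonneg ℓ ξ relu M x θ)))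
  push_cast at h1
  nlinarith

end Descent

/-! ### A convergence criterion for real sequences -/

section Sequences

/-- A nonnegative sequence with infinitely often small values converges to `0` if its increments
are eventually small, and are dominated by a summable sequence while its values are not small. -/
theorem tendsto_zero_of_increments {u : ℕ → ℝ} (hu : ∀ n, 0 ≤ u n)
    (hfreq : ∀ ε > 0, ∃ᶠ n in atTop, u n < ε)
    (hsmall : ∀ ε > 0, ∀ᶠ n in atTop, u (n + 1) ≤ u n + ε)
    (hlarge : ∀ ε > 0, ∃ g : ℕ → ℝ, Summable g ∧ (∀ n, 0 ≤ g n) ∧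
      ∀ n, ε ≤ u n → u (n + 1) ≤ u n + g n) :
    Tendsto u atTop (𝓝 0) := by
  refine Metric.tendsto_atTop.2 fun η hη => ?_
  obtain ⟨ε, hε, hεη⟩ : ∃ ε > 0, 3 * ε < η := ⟨η / 4, by positivity, by linarith⟩
  obtain ⟨g, hg, hg0, hgu⟩ := hlarge ε hε
  obtain ⟨N₁, hN₁⟩ := eventually_atTop.1 (hsmall ε hε)
  obtain ⟨N₂, hN₂⟩ := Metric.cauchySeq_iff.1 hg.hasSum.tendsto_sum_nat.cauchySeq ε hε
  obtain ⟨N, hN, hNu⟩ := frequently_atTop.1 (hfreq ε hε) (max N₁ N₂)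
  have hmono : Monotone fun n => ∑ i ∈ Finset.range n, g i :=
    monotone_nat_of_le_succ fun n => by rw [Finset.sum_range_succ]; linarith [hg0 n]
  -- A step from below `ε` ends below `2 * ε`; growth above `ε` is paid for by `g`, whose sum beyond
  -- `N` is less than `ε`. Hence the total `3 * ε`.
  have hbound : ∀ n, N ≤ n → u n ≤ 2 * ε +
      (∑ i ∈ Finset.range n, g i - ∑ i ∈ Finset.range N, g i) := by
    intro n hn
    induction n, hn using Nat.le_induction with
    | base => linarith
    | succ n hn ih =>
      by_cases h : ε ≤ u n
      · have := hgu n h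
        rw [Finset.sum_range_succ]
        linarith
      · have h1 := hN₁ n ((le_max_left _ _).trans (hN.trans hn))
        have h2 := hmono (show N ≤ n + 1 by omega)
        simp only at h2
        linarith
  refine ⟨N, fun n hn => ?_⟩
  have h1 := hN₂ n ((le_max_right _ _).trans (hN.trans hn)) N ((le_max_right _ _).trans hN)
  rw [Real.dist_eq] at h1
  rw [Real.dist_eq, sub_zero, abs_of_nonneg (hu n)]
  linarith [hbound n hn, le_abs_self (∑ i ∈ Finset.range n, g i - ∑ i ∈ Finset.range N, g i)]

/-- Here `u` is the true and `e` the empirical risk. If `u` stayed above some `ε`, then `γ` would be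
summable. Increments vanish since `γ * √e ≤ √(γ * e)` for `γ ≤ 1`; while `ε ≤ u`, they are summable
since `γ * √e ≤ γ + γ * e ≤ ε⁻¹ * (γ * u) + γ * e`. -/
theorem tendsto_zero_of_summable_of_increments {γ u e : ℕ → ℝ} {C : ℝ} (hC : 0 ≤ C)
    (hγ0 : ∀ n, 0 ≤ γ n) (hγ1 : ∀ n, γ n ≤ 1)
    (hγ : Tendsto (fun N => ∑ n ∈ Finset.range N, γ n) atTop atTop)
    (hu : ∀ n, 0 ≤ u n) (he : ∀ n, 0 ≤ e n)
    (hγu : Summable fun n => γ n * u n) (hγe : Summable fun n => γ n * e n)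
    (hinc : ∀ n, u (n + 1) ≤ u n + C * (γ n * √(e n))) :
    Tendsto u atTop (𝓝 0) := by
  refine tendsto_zero_of_increments hu (fun ε hε => ?_) (fun ε hε => ?_) fun ε hε => ?_
  · by_contra hcon
    rw [not_frequently] at hcon
    obtain ⟨N, hN⟩ := eventually_atTop.1 hcon
    have hsum : Summable γ := by
      rw [← summable_nat_add_iff N]
      refine Summable.of_nonneg_of_le (fun n => hγ0 _) (fun n => ?_)
        (((summable_nat_add_iff N).2 hγu).mul_left ε⁻¹)
      have h1 := mul_le_mul_of_nonneg_left (not_lt.1 (hN (n + N) (by omega))) (hγ0 (n + N))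
      rw [inv_mul_eq_div, le_div_iff₀ hε]
      exact h1
    exact not_tendsto_atTop_of_tendsto_nhds hsum.hasSum.tendsto_sum_nat hγ
  · have h1 : Tendsto (fun n => C * √(γ n * e n)) atTop (𝓝 0) := by
      have := (Real.continuous_sqrt.tendsto 0).comp hγe.tendsto_atTop_zero
      simpa using this.const_mul C
    filter_upwards [h1.eventually_lt_const hε] with n hn
    have h2 : γ n * √(e n) ≤ √(γ n * e n) := by
      rw [Real.sqrt_mul (hγ0 n)]
      gcongr
      exact Real.le_sqrt_of_sq_le (by nlinarith [hγ0 n, hγ1 n])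
    have h3 := mul_le_mul_of_nonneg_left h2 hC
    linarith [hinc n]
  · refine ⟨fun n => C * (ε⁻¹ * (γ n * u n) + γ n * e n),
      ((hγu.mul_left _).add hγe).mul_left C, fun n => ?_, fun n hn => ?_⟩
    · have := mul_nonneg (hγ0 n) (hu n)
      have := mul_nonneg (hγ0 n) (he n)
      positivity
    · have h1 : √(e n) ≤ 1 + e n :=
        Real.sqrt_le_iff.2 ⟨by linarith [he n], by nlinarith [he n]⟩
      have h2 : γ n ≤ ε⁻¹ * (γ n * u n) := by
        rw [inv_mul_eq_div, le_div_iff₀ hε]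
        exact mul_le_mul_of_nonneg_left hn (hγ0 n)
      have h3 : γ n * √(e n) ≤ ε⁻¹ * (γ n * u n) + γ n * e n := by
        nlinarith [mul_le_mul_of_nonneg_left h1 (hγ0 n)]
      linarith [hinc n, mul_le_mul_of_nonneg_left h3 hC]

end Sequences

/-! ### Independence of fresh data from the past -/

section Independence

variable {Ω : Type*} [MeasurableSpace Ω] {P : Measure Ω} [IsProbabilityMeasure P]

/-- If `U` is independent of `(Y, Z)`, and `Y` of `Z`, then `(U, Y)` is independent of `Z`. -/
theorem indepFun_prodMk_left {α β κ : Type*} [MeasurableSpace α] [MeasurableSpace β]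
    [MeasurableSpace κ] {U : Ω → α} {Y : Ω → β} {Z : Ω → κ} (hU : Measurable U)
    (hY : Measurable Y) (hZ : Measurable Z) (h : IndepFun U (fun ω => (Y ω, Z ω)) P)
    (hYZ : IndepFun Y Z P) : IndepFun (fun ω => (U ω, Y ω)) Z P := by
  have hUY : IndepFun U Y P := h.comp measurable_id measurable_fst
  have := Measure.isProbabilityMeasure_map (μ := P) hU.aemeasurable
  have := Measure.isProbabilityMeasure_map (μ := P) hY.aemeasurable
  have := Measure.isProbabilityMeasure_map (μ := P) hZ.aemeasurable
  rw [indepFun_iff_map_prod_eq_prod_map_map (hU.prodMk hY).aemeasurable hZ.aemeasurable]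
  rw [indepFun_iff_map_prod_eq_prod_map_map hU.aemeasurable (hY.prodMk hZ).aemeasurable] at h
  rw [indepFun_iff_map_prod_eq_prod_map_map hU.aemeasurable hY.aemeasurable] at hUY
  rw [indepFun_iff_map_prod_eq_prod_map_map hY.aemeasurable hZ.aemeasurable] at hYZ
  rw [hUY, ← (measurePreserving_prodAssoc (P.map U) (P.map Y) (P.map Z)).symm.map_eq, ← hYZ, ← h,
    Measure.map_map (MeasurableEquiv.measurable _) (hU.prodMk (hY.prodMk hZ))]
  rfl

/-- The joint law is a product, so Tonelli's theorem allows freezing `W` while integrating over `Z`.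
-/
theorem lintegral_eq_of_indepFun {α β : Type*} [MeasurableSpace α] [MeasurableSpace β]
    {W : Ω → α} {Z : Ω → β} (hW : Measurable W) (hZ : Measurable Z) (h : IndepFun W Z P)
    {f : α → β → ENNReal} (hf : Measurable (Function.uncurry f)) :
    ∫⁻ ω, f (W ω) (Z ω) ∂P = ∫⁻ ω, ∫⁻ ω', f (W ω) (Z ω') ∂P ∂P := by
  have := Measure.isProbabilityMeasure_map (μ := P) hZ.aemeasurable
  rw [indepFun_iff_map_prod_eq_prod_map_map hW.aemeasurable hZ.aemeasurable] at h
  have h1 : ∫⁻ ω, f (W ω) (Z ω) ∂P =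
      ∫⁻ p, Function.uncurry f p ∂(P.map fun ω => (W ω, Z ω)) :=
    (lintegral_map hf (hW.prodMk hZ)).symm
  rw [h1, h, lintegral_prod _ hf.aemeasurable,
    lintegral_map (Measurable.lintegral_prod_right' hf) hW]
  refine lintegral_congr fun ω => ?_
  exact lintegral_map (hf.comp measurable_prodMk_left) hZ

variable {α β : Type*} [MeasurableSpace α] [MeasurableSpace β]

/-- The initial value together with the data of the first `n` steps. -/
def pastData (U : Ω → α) (X : ℕ → ℕ → Ω → β) (n : ℕ) (ω : Ω) :
    α × ({p : ℕ × ℕ // p.1 < n} → β) :=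
  (U ω, fun p => X p.1.1 p.1.2 ω)

variable {U : Ω → α} {X : ℕ → ℕ → Ω → β}

omit [MeasurableSpace Ω] in
theorem measurable_pastData {mΩ : MeasurableSpace Ω} {n : ℕ} (hU : Measurable U)
    (hX : ∀ k < n, ∀ m, Measurable (X k m)) : Measurable (pastData U X n) :=
  hU.prodMk (measurable_pi_lambda _ fun p => hX _ p.2 _)

/-- The past only involves data with first index below `n`, disjoint from `(n, m)`; the initial
value is independent of both together. -/
theorem indepFun_pastData (hU : Measurable U) (hX : ∀ n m, Measurable (X n m))
    (hX_indep : iIndepFun (fun p : ℕ × ℕ => X p.1 p.2) P)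
    (hU_indep : IndepFun U (fun ω (p : ℕ × ℕ) => X p.1 p.2 ω) P) (n m : ℕ) :
    IndepFun (pastData U X n) (X n m) P := by
  have hY : Measurable fun ω (p : {p : ℕ × ℕ // p.1 < n}) => X p.1.1 p.1.2 ω :=
    measurable_pi_lambda _ fun p => hX _ _
  refine indepFun_prodMk_left hU hY (hX n m) ?_ ?_
  · exact hU_indep.comp (φ := id) (ψ := fun f : ℕ × ℕ → β =>
      ((fun p : {p : ℕ × ℕ // p.1 < n} => f p.1), f (n, m))) measurable_id
      ((measurable_pi_lambda _ fun p => measurable_pi_apply _).prodMk (measurable_pi_apply _))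
  · have h := indep_iSup_of_disjoint (fun p : ℕ × ℕ => (hX p.1 p.2).comap_le) hX_indep
      (show Disjoint {p : ℕ × ℕ | p.1 < n} {(n, m)} by simp)
    refine indep_of_indep_of_le_left (indep_of_indep_of_le_right h ?_) ?_
    · exact le_iSup₂_of_le (n, m) rfl le_rfl
    · refine measurable_iff_comap_le.1 (@measurable_pi_lambda _ _ _ (_) _ _ fun p => ?_)
      refine Measurable.mono (comap_measurable (X p.1.1 p.1.2)) ?_ le_rfl
      exact le_iSup₂_of_le p.1 p.2 le_rfl

omit [MeasurableSpace Ω] in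
theorem measurable_data_of_lt {n k : ℕ} (hk : k < n) (m : ℕ) :
    Measurable[MeasurableSpace.comap (pastData U X n) inferInstance] (X k m) :=
  ((measurable_pi_apply (⟨(k, m), hk⟩ : {p : ℕ × ℕ // p.1 < n})).comp measurable_snd).comp
    (comap_measurable (pastData U X n))

omit [MeasurableSpace Ω] in
theorem measurable_initial (n : ℕ) :
    Measurable[MeasurableSpace.comap (pastData U X n) inferInstance] U :=
  measurable_fst.comp (comap_measurable (pastData U X n))

omit [MeasurableSpace Ω] in
theorem comap_pastData_le_succ (n : ℕ) :
    MeasurableSpace.comap (pastData U X n) inferInstance ≤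
      MeasurableSpace.comap (pastData U X (n + 1)) inferInstance := by
  refine measurable_iff_comap_le.1 (measurable_pastData (measurable_initial (n + 1))
    fun p hp m => measurable_data_of_lt ?_ m)
  omega

end Independence

/-! ### The true risk: regularity and relation to the empirical risk -/

section Risk

variable (ℓ : ℕ → ℕ) {K : ℕ} (ξ : EuclideanSpace ℝ (Fin (ℓ (K + 1))))
  {Ω : Type*} [MeasurableSpace Ω] {P : Measure Ω} [IsProbabilityMeasure P]

omit [IsProbabilityMeasure P] in
theorem risk_nonneg (L : ℕ) (ξ : EuclideanSpace ℝ (Fin (ℓ L)))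
    (X : Ω → EuclideanSpace ℝ (Fin (ℓ 0))) (θ : EuclideanSpace ℝ (Fin (paramCount ℓ L))) :
    0 ≤ risk ℓ L ξ P X θ :=
  integral_nonneg fun _ => by positivity

theorem norm_sq_add_one_le {n : ℕ} {a b : ℝ} {x : EuclideanSpace ℝ (Fin n)}
    (hx : ∀ i, x i ∈ Set.Icc a b) :
    ‖x‖ ^ 2 + 1 ≤ (max (max |a| |b|) 1) ^ 2 * ((n : ℝ) + 1) := by
  have h1 : 1 ≤ (max (max |a| |b|) 1) ^ 2 := one_le_pow₀ (le_max_right _ _)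
  have h2 : ‖x‖ ^ 2 ≤ n * (max (max |a| |b|) 1) ^ 2 := by
    rw [EuclideanSpace.real_norm_sq_eq]
    refine (Finset.sum_le_sum fun i _ => ?_).trans_eq
      (by rw [Finset.sum_const, Finset.card_univ, Fintype.card_fin, nsmul_eq_mul])
    rw [← sq_abs]
    exact pow_le_pow_left₀ (abs_nonneg _)
      ((abs_le_max_abs_abs (hx i).1 (hx i).2).trans (le_max_left _ _)) 2
  linarith

variable {X : Ω → EuclideanSpace ℝ (Fin (ℓ 0))} {D : ℝ}

theorem integrable_sqLoss (hX : Measurable X) (hD : ∀ ω, ‖X ω‖ ≤ D)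
    (θ : EuclideanSpace ℝ (Fin (paramCount ℓ (K + 1)))) :
    Integrable (fun ω => ‖realization ℓ relu θ (K + 1) (X ω) - ξ‖ ^ 2) P := by
  obtain ⟨C, hC, h⟩ := exists_layerInput_lipschitz ℓ (L := K + 1) ‖θ‖ D (K + 1) le_rfl
  refine Integrable.of_bound (measurable_sqLoss ℓ measurable_const hX K ξ).aestronglyMeasurable
    ((C + ‖ξ‖) ^ 2) (Eventually.of_forall fun ω => ?_)
  rw [Real.norm_of_nonneg (by positivity)]
  have := (h θ θ le_rfl le_rfl (X ω) (hD ω)).1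
  gcongr
  exact (norm_sub_le _ _).trans (by linarith)

/-- Both errors are at most `C + ‖ξ‖`, so their squares differ by at most `2 * (C + ‖ξ‖)` times
their difference. -/
theorem exists_risk_lipschitz (hX : Measurable X) (hD : ∀ ω, ‖X ω‖ ≤ D) (ρ : ℝ) :
    ∃ C : ℝ, 0 ≤ C ∧ ∀ θ θ' : EuclideanSpace ℝ (Fin (paramCount ℓ (K + 1))),
      ‖θ‖ ≤ ρ → ‖θ'‖ ≤ ρ → risk ℓ (K + 1) ξ P X θ ≤ C ∧
        risk ℓ (K + 1) ξ P X θ ≤ risk ℓ (K + 1) ξ P X θ' + C * ‖θ - θ'‖ := by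
  obtain ⟨C, hC, h⟩ := exists_layerInput_lipschitz ℓ (L := K + 1) ρ D (K + 1) le_rfl
  refine ⟨(C + ‖ξ‖) ^ 2 + 2 * (C + ‖ξ‖) * C, by positivity, fun θ θ' hθ hθ' => ?_⟩
  have hbound : ∀ ω, ‖realization ℓ relu θ (K + 1) (X ω) - ξ‖ ≤ C + ‖ξ‖ := fun ω =>
    (norm_sub_le _ _).trans (by linarith [(h θ θ' hθ hθ' (X ω) (hD ω)).1])
  have hbound' : ∀ ω, ‖realization ℓ relu θ' (K + 1) (X ω) - ξ‖ ≤ C + ‖ξ‖ := fun ω =>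
    (norm_sub_le _ _).trans (by linarith [(h θ' θ hθ' hθ (X ω) (hD ω)).1])
  constructor
  · have h1 : risk ℓ (K + 1) ξ P X θ ≤ ∫ _, (C + ‖ξ‖) ^ 2 ∂P :=
      integral_mono (integrable_sqLoss ℓ ξ hX hD θ) (integrable_const _) fun ω => by
        have := hbound ω
        simp only
        gcongr
    rw [integral_const] at h1
    simp only [probReal_univ, one_smul] at h1
    have : 0 ≤ 2 * (C + ‖ξ‖) * C := by positivity
    linarith
  · have h1 : risk ℓ (K + 1) ξ P X θ ≤
        ∫ ω, (‖realization ℓ relu θ' (K + 1) (X ω) - ξ‖ ^ 2 +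
          2 * (C + ‖ξ‖) * (C * ‖θ - θ'‖)) ∂P := by
      refine integral_mono (integrable_sqLoss ℓ ξ hX hD θ)
        ((integrable_sqLoss ℓ ξ hX hD θ').add (integrable_const _)) fun ω => ?_
      have h2 := (h θ θ' hθ hθ' (X ω) (hD ω)).2.2.1
      have h3 := norm_le_norm_add_norm_sub' (realization ℓ relu θ (K + 1) (X ω) - ξ)
        (realization ℓ relu θ' (K + 1) (X ω) - ξ)
      rw [sub_sub_sub_cancel_right] at h3
      have h4 := hbound ω
      have h5 := hbound' ω
      have h6 : 0 ≤ C * ‖θ - θ'‖ := by positivity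
      simp only
      nlinarith [norm_nonneg (realization ℓ relu θ (K + 1) (X ω) - ξ),
        norm_nonneg (realization ℓ relu θ' (K + 1) (X ω) - ξ)]
    rw [integral_add (integrable_sqLoss ℓ ξ hX hD θ') (integrable_const _), integral_const,
      probReal_univ, one_smul] at h1
    have h2 : 0 ≤ (C + ‖ξ‖) ^ 2 * ‖θ - θ'‖ := by positivity
    change _ ≤ risk ℓ (K + 1) ξ P X θ' + _ at h1
    linarith

theorem measurable_risk (hX : Measurable X) :
    Measurable fun θ : EuclideanSpace ℝ (Fin (paramCount ℓ (K + 1))) =>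
      risk ℓ (K + 1) ξ P X θ := by
  have h := measurable_sqLoss ℓ
    (measurable_fst (α := EuclideanSpace ℝ (Fin (paramCount ℓ (K + 1)))) (β := Ω))
    (hX.comp measurable_snd) K ξ
  exact (StronglyMeasurable.integral_prod_right' (ν := P) h.stronglyMeasurable).measurable

theorem ofReal_risk (hX : Measurable X) (hD : ∀ ω, ‖X ω‖ ≤ D)
    (θ : EuclideanSpace ℝ (Fin (paramCount ℓ (K + 1)))) :
    ENNReal.ofReal (risk ℓ (K + 1) ξ P X θ) =
      ∫⁻ ω, ENNReal.ofReal (‖realization ℓ relu θ (K + 1) (X ω) - ξ‖ ^ 2) ∂P :=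
  ofReal_integral_eq_lintegral_ofReal (integrable_sqLoss ℓ ξ hX hD θ)
    (Eventually.of_forall fun ω => by positivity)

omit [IsProbabilityMeasure P] in
theorem risk_congr_of_identDistrib {X' : Ω → EuclideanSpace ℝ (Fin (ℓ 0))}
    (h : IdentDistrib X' X P P) (θ : EuclideanSpace ℝ (Fin (paramCount ℓ (K + 1)))) :
    risk ℓ (K + 1) ξ P X' θ = risk ℓ (K + 1) ξ P X θ :=
  (h.comp (measurable_sqLoss ℓ measurable_const measurable_id K ξ)).integral_eq

/-- On events which belong to the past, the expected empirical risk on fresh data is the expected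
true risk. -/
theorem setLIntegral_empRisk_eq {α : Type*} [MeasurableSpace α] {U : Ω → α}
    {Θ : Ω → EuclideanSpace ℝ (Fin (paramCount ℓ (K + 1)))} (hU : Measurable U)
    (hΘ : Measurable Θ) {x : ℕ → Ω → EuclideanSpace ℝ (Fin (ℓ 0))} (hx : ∀ m, Measurable (x m))
    (hD : ∀ m ω, ‖x m ω‖ ≤ D) (hident : ∀ m, IdentDistrib (x m) X P P)
    (hindep : ∀ m, IndepFun (fun ω => (U ω, Θ ω)) (x m) P) {M : ℕ} (hM : 1 ≤ M) {s : Set α}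
    (hs : MeasurableSet s) :
    ∫⁻ ω in U ⁻¹' s,
        ENNReal.ofReal (empRisk ℓ (K + 1) ξ relu M (fun m => x m ω) (Θ ω)) ∂P =
      ∫⁻ ω in U ⁻¹' s, ENNReal.ofReal (risk ℓ (K + 1) ξ P X (Θ ω)) ∂P := by
  have hM' : (M : ENNReal) ≠ 0 := by exact_mod_cast (show M ≠ 0 by omega)
  have hloss : ∀ m, Measurable fun ω =>
      ENNReal.ofReal (‖realization ℓ relu (Θ ω) (K + 1) (x m ω) - ξ‖ ^ 2) := fun m =>
    (measurable_sqLoss ℓ hΘ (hx m) K ξ).ennreal_ofReal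
  have hone : ∀ m, ∫⁻ ω in U ⁻¹' s,
      ENNReal.ofReal (‖realization ℓ relu (Θ ω) (K + 1) (x m ω) - ξ‖ ^ 2) ∂P =
      ∫⁻ ω in U ⁻¹' s, ENNReal.ofReal (risk ℓ (K + 1) ξ P X (Θ ω)) ∂P := by
    intro m
    -- The event enters as an indicator, so that the integrand is a function of `(U, Θ)` and of the
    -- independent data.
    let f : α × EuclideanSpace ℝ (Fin (paramCount ℓ (K + 1))) → EuclideanSpace ℝ (Fin (ℓ 0)) →
        ENNReal := fun w z => s.indicator 1 w.1 *
          ENNReal.ofReal (‖realization ℓ relu w.2 (K + 1) z - ξ‖ ^ 2)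
    have hf : Measurable (Function.uncurry f) := by
      refine Measurable.mul ?_ ?_
      · exact (measurable_one.indicator hs).comp (measurable_fst.comp measurable_fst)
      · exact (measurable_sqLoss ℓ (measurable_snd.comp measurable_fst) measurable_snd K
          ξ).ennreal_ofReal
    have h := lintegral_eq_of_indepFun (hU.prodMk hΘ) (hx m) (hindep m) hf
    have hind : ∀ (t : Ω → ENNReal) (ω : Ω), s.indicator 1 (U ω) * t ω =
        (U ⁻¹' s).indicator t ω := fun t ω => by
      by_cases hω : U ω ∈ s <;> simp [Set.indicator, hω]
    rw [← lintegral_indicator (hU hs), ← lintegral_indicator (hU hs)]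
    calc _ = ∫⁻ ω, f (U ω, Θ ω) (x m ω) ∂P := lintegral_congr fun ω => (hind _ ω).symm
      _ = ∫⁻ ω, ∫⁻ ω', f (U ω, Θ ω) (x m ω') ∂P ∂P := h
      _ = _ := by
          refine lintegral_congr fun ω => ?_
          rw [← hind, ← risk_congr_of_identDistrib ℓ ξ (hident m), ofReal_risk ℓ ξ (hx m) (hD m)]
          exact lintegral_const_mul _
            (measurable_sqLoss ℓ measurable_const (hx m) K ξ).ennreal_ofReal
  have hemp : ∀ ω, ENNReal.ofReal (empRisk ℓ (K + 1) ξ relu M (fun m => x m ω) (Θ ω)) =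
      (M : ENNReal)⁻¹ * ∑ m ∈ Finset.Icc 1 M,
        ENNReal.ofReal (‖realization ℓ relu (Θ ω) (K + 1) (x m ω) - ξ‖ ^ 2) := by
    intro ω
    rw [empRisk, ENNReal.ofReal_mul (by positivity), one_div,
      ENNReal.ofReal_inv_of_pos (by exact_mod_cast hM), ENNReal.ofReal_natCast,
      ENNReal.ofReal_sum_of_nonneg fun _ _ => by positivity]
  simp_rw [hemp]
  rw [lintegral_const_mul _ (Finset.measurable_sum _ fun m _ => hloss m),
    lintegral_finsetSum _ fun m _ => hloss m, Finset.sum_congr rfl fun m _ => hone m,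
    Finset.sum_const, Nat.card_Icc, Nat.add_sub_cancel, nsmul_eq_mul, ← mul_assoc,
    ENNReal.inv_mul_cancel hM' (ENNReal.natCast_ne_top M), one_mul]

end Risk

/-! ### Estimates along a single trajectory -/

section Path

variable (ℓ : ℕ → ℕ) {K : ℕ} (ξ : EuclideanSpace ℝ (Fin (ℓ (K + 1))))
  {M : ℕ → ℕ} (hM : ∀ n, 1 ≤ M n) {x : ℕ → ℕ → EuclideanSpace ℝ (Fin (ℓ 0))}
  {θ g : ℕ → EuclideanSpace ℝ (Fin (paramCount ℓ (K + 1)))}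
  (hg : ∀ n h, inner ℝ (g n) h = empTangent ℓ K ξ (M n) (x n) (θ n) h)
  {γ : ℕ → ℝ} (hγ : ∀ n, 0 ≤ γ n) (hθ : ∀ n, θ (n + 1) = θ n - γ n • g n)
  {S δ : ℝ} (hS : ∀ n m, ‖x n m‖ ^ 2 + 1 ≤ S) (hδ : δ < 1)
  (hstep : ∀ n, γ n * ((K + 1) ^ 2 * (2 * lyapunov ℓ (K + 1) ξ (θ 0) +
    4 * ((K + 1 : ℕ) : ℝ) ^ 2 * ‖ξ‖ ^ 2 + 1) ^ K * S) ≤ δ)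

include hM hg hγ hθ hS hδ hstep in
/-- Along gradient descent with small learning rates, the Lyapunov function decreases by at least
a multiple of the empirical risks. -/
theorem lyapunov_add_sum_le (n : ℕ) :
    lyapunov ℓ (K + 1) ξ (θ n) + 4 * (K + 1) * (1 - δ) *
      ∑ k ∈ Finset.range n, γ k * empRisk ℓ (K + 1) ξ relu (M k) (x k) (θ k) ≤
        lyapunov ℓ (K + 1) ξ (θ 0) := by
  induction n with
  | zero => simp
  | succ n ih =>
    have hS0 : 0 ≤ S := le_trans (by positivity) (hS 0 0)
    have hsum : 0 ≤ 4 * (K + 1) * (1 - δ) *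
        ∑ k ∈ Finset.range n, γ k * empRisk ℓ (K + 1) ξ relu (M k) (x k) (θ k) := by
      have h1 : 0 ≤ 1 - δ := by linarith
      have h2 : 0 ≤ ∑ k ∈ Finset.range n, γ k * empRisk ℓ (K + 1) ξ relu (M k) (x k) (θ k) :=
        Finset.sum_nonneg fun k _ => mul_nonneg (hγ k) (empRisk_nonneg ℓ ξ _ _ _ _)
      positivity
    have hn := norm_sq_le_lyapunov ℓ ξ (θ n) (by omega)
    -- By induction `V` has not exceeded its initial value, so coercivity carries the rate condition
    -- over to time `n`.
    have hrate : γ n * ((K + 1) ^ 2 * (‖θ n‖ ^ 2 + 1) ^ K * S) ≤ δ := by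
      refine le_trans ?_ (hstep n)
      have := hγ n
      gcongr
      linarith
    have h := lyapunov_descent ℓ ξ (hM n) (hg n) (hS n) (hγ n) hrate
    rw [← hθ] at h
    rw [Finset.sum_range_succ, mul_add]
    linarith

include hM hg hγ hθ hS hδ hstep in
theorem norm_sq_le_initial (n : ℕ) :
    ‖θ n‖ ^ 2 ≤ 2 * lyapunov ℓ (K + 1) ξ (θ 0) + 4 * ((K + 1 : ℕ) : ℝ) ^ 2 * ‖ξ‖ ^ 2 := by
  have h := lyapunov_add_sum_le ℓ ξ hM hg hγ hθ hS hδ hstep n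
  have h1 : 0 ≤ 1 - δ := by linarith
  have h2 : 0 ≤ ∑ k ∈ Finset.range n, γ k * empRisk ℓ (K + 1) ξ relu (M k) (x k) (θ k) :=
    Finset.sum_nonneg fun k _ => mul_nonneg (hγ k) (empRisk_nonneg ℓ ξ _ _ _ _)
  have h3 : 0 ≤ 4 * (K + 1) * (1 - δ) *
      ∑ k ∈ Finset.range n, γ k * empRisk ℓ (K + 1) ξ relu (M k) (x k) (θ k) := by positivity
  have hn := norm_sq_le_lyapunov ℓ ξ (θ n) (by omega)
  linarith

include hM hg hγ hθ hS hδ hstep in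
-- Coercivity also bounds `V` from below by `-2 L ^ 2 * ‖ξ‖ ^ 2`, so the total decrease is finite.
theorem sum_empRisk_le (n : ℕ) :
    ∑ k ∈ Finset.range n, γ k * empRisk ℓ (K + 1) ξ relu (M k) (x k) (θ k) ≤
      (lyapunov ℓ (K + 1) ξ (θ 0) + 2 * ((K + 1 : ℕ) : ℝ) ^ 2 * ‖ξ‖ ^ 2) /
        (4 * (K + 1) * (1 - δ)) := by
  have h := lyapunov_add_sum_le ℓ ξ hM hg hγ hθ hS hδ hstep n
  have hn := norm_sq_le_lyapunov ℓ ξ (θ n) (by omega)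
  have h1 : 0 < 1 - δ := by linarith
  rw [le_div_iff₀ (by positivity)]
  nlinarith [sq_nonneg ‖θ n‖]

include hM hg hγ hθ hS hδ hstep in
/-- Along gradient descent with small learning rates, the true risk converges to zero provided
that it is summable with the learning rates as weights. -/
theorem tendsto_risk_of_summable {Ω : Type*} [MeasurableSpace Ω] {P : Measure Ω}
    [IsProbabilityMeasure P] {X : Ω → EuclideanSpace ℝ (Fin (ℓ 0))} (hX : Measurable X)
    (hD : ∀ ω, ‖X ω‖ ≤ S) (hγ1 : ∀ n, γ n ≤ 1)
    (hγ_sum : Tendsto (fun N => ∑ n ∈ Finset.range N, γ n) atTop atTop)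
    (hsum : Summable fun n => γ n * risk ℓ (K + 1) ξ P X (θ n)) :
    Tendsto (fun n => risk ℓ (K + 1) ξ P X (θ n)) atTop (𝓝 0) := by
  have hS0 : 0 ≤ S := le_trans (by positivity) (hS 0 0)
  set ρ := √(2 * lyapunov ℓ (K + 1) ξ (θ 0) + 4 * ((K + 1 : ℕ) : ℝ) ^ 2 * ‖ξ‖ ^ 2) with hρ
  have hθρ : ∀ n, ‖θ n‖ ≤ ρ := fun n =>
    Real.le_sqrt_of_sq_le (norm_sq_le_initial ℓ ξ hM hg hγ hθ hS hδ hstep n)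
  obtain ⟨C, hC, hlip⟩ := exists_risk_lipschitz (P := P) ℓ ξ hX hD ρ
  -- On the ball of radius `ρ`, the squared gradient is at most `Λ` times the empirical risk.
  set Λ := 4 * ((K + 1) ^ 2 * (ρ ^ 2 + 1) ^ K * S) with hΛ
  refine tendsto_zero_of_summable_of_increments (C := C * √Λ)
    (e := fun n => empRisk ℓ (K + 1) ξ relu (M n) (x n) (θ n)) (by positivity) hγ hγ1 hγ_sum
    (fun n => risk_nonneg ℓ _ ξ X _) (fun n => empRisk_nonneg ℓ ξ _ _ _ _) hsum
    (summable_of_sum_range_le (fun n => mul_nonneg (hγ n) (empRisk_nonneg ℓ ξ _ _ _ _))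
      (sum_empRisk_le ℓ ξ hM hg hγ hθ hS hδ hstep)) fun n => ?_
  have h1 := (hlip (θ (n + 1)) (θ n) (hθρ _) (hθρ _)).2
  have h2 : ‖θ (n + 1) - θ n‖ = γ n * ‖g n‖ := by
    rw [hθ, sub_sub_cancel_left, norm_neg, norm_smul, Real.norm_of_nonneg (hγ n)]
  have h3 : ‖g n‖ ≤ √Λ * √(empRisk ℓ (K + 1) ξ relu (M n) (x n) (θ n)) := by
    rw [← Real.sqrt_mul (by positivity)]
    refine Real.le_sqrt_of_sq_le ((norm_sq_gradient_le ℓ ξ (hM n) (hg n) (hS n)).trans ?_)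
    refine mul_le_mul_of_nonneg_right ?_ (empRisk_nonneg ℓ ξ _ _ _ _)
    rw [hΛ]
    have := hθρ n
    gcongr
  have h4 := mul_le_mul_of_nonneg_left h3 (mul_nonneg hC (hγ n))
  rw [h2] at h1
  linarith

end Path

/-! ### Width products and the learning rate condition -/

/-- Every width after the input contributes a factor of at least `2`, and `2 ^ (K + 1) ≥ K + 1`.
This supplies the second factor `L` that the descent estimate needs. -/
theorem prod_width_ge (ℓ : ℕ → ℕ) (hℓ : ∀ k, 1 ≤ ℓ k) (K : ℕ) :
    ((K : ℝ) + 1) * ((ℓ 0 : ℝ) + 1) ≤ ∏ p ∈ Finset.range (K + 1 + 1), ((ℓ p : ℝ) + 1) := by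
  rw [Finset.prod_range_succ']
  refine mul_le_mul_of_nonneg_right ?_ (by positivity)
  have h1 : (2 : ℝ) ^ (K + 1) ≤ ∏ p ∈ Finset.range (K + 1), ((ℓ (p + 1) : ℝ) + 1) := by
    have h := Finset.prod_le_prod (s := Finset.range (K + 1)) (f := fun _ => (2 : ℝ))
      (g := fun p => (ℓ (p + 1) : ℝ) + 1) (fun _ _ => by norm_num) fun p _ => by
        have : (1 : ℝ) ≤ ℓ (p + 1) := by exact_mod_cast hℓ _
        linarith
    simpa using h
  refine le_trans ?_ h1
  exact_mod_cast (Nat.lt_two_pow_self (n := K + 1)).le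

theorem prod_width_le (ℓ : ℕ → ℕ) (hℓ : ∀ k, 1 ≤ ℓ k) (K : ℕ) :
    ∏ p ∈ Finset.range (K + 1 + 1), ((ℓ p : ℝ) + 1) ≤
      (paramCount ℓ (K + 1) : ℝ) ^ (K + 1 + 1) := by
  have key : ∀ p ≤ K, ℓ (p + 1) * (ℓ p + 1) ≤ paramCount ℓ (K + 1) := fun p hp =>
    Finset.single_le_sum (f := fun h => ℓ (h + 1) * (ℓ h + 1)) (fun _ _ => Nat.zero_le _)
      (Finset.mem_range.2 (by omega))
  have hle : ∀ p ∈ Finset.range (K + 1 + 1), ((ℓ p : ℝ) + 1) ≤ (paramCount ℓ (K + 1) : ℝ) := by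
    intro p hp
    rw [Finset.mem_range] at hp
    norm_cast
    rcases Nat.lt_or_ge p (K + 1) with h | h
    · exact (Nat.le_mul_of_pos_left _ (hℓ (p + 1))).trans (key p (by omega))
    -- The output width has no following layer; here `ℓ (K + 1) * (ℓ K + 1) ≥ 2 * ℓ (K + 1)`
    -- suffices.
    · obtain rfl : p = K + 1 := by omega
      refine le_trans ?_ (key K le_rfl)
      nlinarith [hℓ K, hℓ (K + 1)]
  calc _ ≤ ∏ _p ∈ Finset.range (K + 1 + 1), (paramCount ℓ (K + 1) : ℝ) :=
        Finset.prod_le_prod (fun _ _ => by positivity) hle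
    _ = _ := by simp

theorem one_le_paramCount (ℓ : ℕ → ℕ) (hℓ : ∀ k, 1 ≤ ℓ k) (K : ℕ) :
    1 ≤ paramCount ℓ (K + 1) := by
  rw [paramCount_succ]
  have := hℓ (K + 1)
  omega

/-- The bound on the learning rates in terms of the Lyapunov function, in the form in which the
descent estimate uses it. -/
theorem rate_le_of_lyapunov (ℓ : ℕ → ℕ) (hℓ : ∀ k, 1 ≤ ℓ k) {K : ℕ} {γ α y δ : ℝ} (hγ : 0 ≤ γ)
    (hα : 1 ≤ α) (hy : 1 ≤ y)
    (h : γ * ((K + 1 : ℕ) : ℝ) * α ^ 2 *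
      (∏ p ∈ Finset.range (K + 1 + 1), ((ℓ p : ℝ) + 1)) * y ^ K ≤ δ) :
    γ * ((K + 1) ^ 2 * y ^ K * (α ^ 2 * ((ℓ 0 : ℝ) + 1))) ≤ δ ∧ γ * y ^ K ≤ δ := by
  have h1 := prod_width_ge ℓ hℓ K
  have hα2 : 1 ≤ α ^ 2 := one_le_pow₀ hα
  have h2 : 0 ≤ γ * (K + 1) * α ^ 2 * y ^ K := by positivity
  have h3 := mul_le_mul_of_nonneg_left h1 h2
  push_cast at h
  have h4 : γ * ((K + 1) ^ 2 * y ^ K * (α ^ 2 * ((ℓ 0 : ℝ) + 1))) ≤ δ := by nlinarith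
  refine ⟨h4, le_trans ?_ h4⟩
  refine mul_le_mul_of_nonneg_left ?_ hγ
  have hy0 : 0 ≤ y ^ K := by positivity
  have h5 : (1 : ℝ) ≤ (K + 1) ^ 2 := one_le_pow₀ (by simp)
  have h6 : 1 ≤ α ^ 2 * ((ℓ 0 : ℝ) + 1) := one_le_mul_of_one_le_of_one_le hα2 (by simp)
  calc y ^ K = 1 * y ^ K * 1 := by ring
    _ ≤ _ := by gcongr

/-! ### From empirical to true risk along the process -/

section StochasticGradientDescent

variable (ℓ : ℕ → ℕ) {K : ℕ} (ξ : EuclideanSpace ℝ (Fin (ℓ (K + 1))))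
  {Ω : Type*} [MeasurableSpace Ω] {P : Measure Ω} [IsProbabilityMeasure P]
  {X : ℕ → ℕ → Ω → EuclideanSpace ℝ (Fin (ℓ 0))} {M : ℕ → ℕ}
  {G : ℕ → EuclideanSpace ℝ (Fin (paramCount ℓ (K + 1))) → Ω →
    EuclideanSpace ℝ (Fin (paramCount ℓ (K + 1)))}
  (hG : ∀ n θ ω h, inner ℝ (G n θ ω) h = empTangent ℓ K ξ (M n) (fun m => X n m ω) θ h)
  {γ : ℕ → ℝ} {Θ : ℕ → Ω → EuclideanSpace ℝ (Fin (paramCount ℓ (K + 1)))}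
  (hΘ_step : ∀ n ω, Θ (n + 1) ω = Θ n ω - γ n • G n (Θ n ω) ω)

omit [MeasurableSpace Ω] in
include hG hΘ_step in
/-- The SGD process is adapted to the filtration generated by the initial value and the data. -/
theorem measurable_process (n : ℕ) :
    Measurable[MeasurableSpace.comap (pastData (Θ 0) X n) inferInstance] (Θ n) := by
  induction n with
  | zero => exact measurable_initial 0
  | succ n ih =>
    have h1 : Measurable[MeasurableSpace.comap (pastData (Θ 0) X (n + 1)) inferInstance] (Θ n) :=
      ih.mono (comap_pastData_le_succ n) le_rfl
    have h2 : Measurable[MeasurableSpace.comap (pastData (Θ 0) X (n + 1)) inferInstance]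
        fun ω => G n (Θ n ω) ω :=
      measurable_of_inner_eq_empTangent ℓ ξ (M n) (x := fun ω m => X n m ω)
        (fun ω h => hG n (Θ n ω) ω h) h1 fun m => measurable_data_of_lt (Nat.lt_succ_self n) m
    rw [show Θ (n + 1) = fun ω => Θ n ω - γ n • G n (Θ n ω) ω from funext (hΘ_step n)]
    exact h1.sub (h2.const_smul (γ n))

variable (hX_meas : ∀ n m, Measurable (X n m))
  (hX_indep : iIndepFun (fun p : ℕ × ℕ => X p.1 p.2) P)
  (hX_ident : ∀ n m, IdentDistrib (X n m) (X 0 0) P P) (hM : ∀ n, 1 ≤ M n)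
  (hγ : ∀ n, 0 ≤ γ n) (hΘ_meas : ∀ n, Measurable (Θ n))
  (hΘ_indep : IndepFun (Θ 0) (fun ω (p : ℕ × ℕ) => X p.1 p.2 ω) P)
  {S δ : ℝ} (hS : ∀ n m ω, ‖X n m ω‖ ^ 2 + 1 ≤ S) (hδ : δ < 1)
  (hstep : ∀ᵐ ω ∂P, ∀ n, γ n * ((K + 1) ^ 2 * (2 * lyapunov ℓ (K + 1) ξ (Θ 0 ω) +
    4 * ((K + 1 : ℕ) : ℝ) ^ 2 * ‖ξ‖ ^ 2 + 1) ^ K * S) ≤ δ)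

include hS in
omit [MeasurableSpace Ω] in
theorem norm_data_le (n m : ℕ) (ω : Ω) : ‖X n m ω‖ ≤ S := by
  nlinarith [hS n m ω, sq_nonneg (‖X n m ω‖ - 1)]

include hG hΘ_step hX_meas hX_indep hX_ident hM hΘ_meas hΘ_indep hS in
theorem setLIntegral_process_eq (n : ℕ) (c : ℝ) :
    ∫⁻ ω in Θ 0 ⁻¹' Metric.closedBall 0 c,
        ENNReal.ofReal (empRisk ℓ (K + 1) ξ relu (M n) (fun m => X n m ω) (Θ n ω)) ∂P =
      ∫⁻ ω in Θ 0 ⁻¹' Metric.closedBall 0 c,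
        ENNReal.ofReal (risk ℓ (K + 1) ξ P (X 0 0) (Θ n ω)) ∂P := by
  refine setLIntegral_empRisk_eq ℓ ξ (hΘ_meas 0) (hΘ_meas n) (hX_meas n)
    (fun m ω => norm_data_le ℓ hS n m ω) (hX_ident n) (fun m => ?_) (hM n)
    measurableSet_closedBall
  refine indep_of_indep_of_le_left
    (indepFun_pastData (hΘ_meas 0) hX_meas hX_indep hΘ_indep n m) ?_
  exact measurable_iff_comap_le.1
    ((measurable_initial n).prodMk (measurable_process ℓ ξ hG hΘ_step n))

include hG hΘ_step hX_meas hX_indep hX_ident hM hγ hΘ_meas hΘ_indep hS hδ hstep in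
/-- Almost surely, the true risks along the SGD process are summable with the learning rates as
weights. -/
theorem ae_summable_risk :
    ∀ᵐ ω ∂P, Summable fun n => γ n * risk ℓ (K + 1) ξ P (X 0 0) (Θ n ω) := by
  have hδ' : 0 < 1 - δ := by linarith
  have hemp_meas : ∀ n, Measurable fun ω =>
      empRisk ℓ (K + 1) ξ relu (M n) (fun m => X n m ω) (Θ n ω) := fun n =>
    measurable_const.mul (Finset.measurable_sum _ fun m _ =>
      measurable_sqLoss ℓ (hΘ_meas n) (hX_meas n m) K ξ)
  have hrisk_meas : ∀ n, Measurable fun ω => risk ℓ (K + 1) ξ P (X 0 0) (Θ n ω) := fun n =>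
    (measurable_risk ℓ ξ (hX_meas 0 0)).comp (hΘ_meas n)
  -- For one layer `Θ 0` may be unbounded and the initial `V` not integrable; expectations are taken
  -- on balls for `Θ 0`, which exhaust the space.
  have hball : ∀ c : ℕ, ∀ᵐ ω ∂P, ω ∈ Θ 0 ⁻¹' Metric.closedBall 0 (c : ℝ) →
      ∑' n, ENNReal.ofReal (γ n) * ENNReal.ofReal (risk ℓ (K + 1) ξ P (X 0 0) (Θ n ω)) < ⊤ := by
    intro c
    have hs : MeasurableSet (Θ 0 ⁻¹' Metric.closedBall 0 (c : ℝ)) :=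
      hΘ_meas 0 measurableSet_closedBall
    -- The bound of `sum_empRisk_le`, with the initial `V` estimated by `lyapunov_le` for `‖Θ 0‖ ≤
    -- c`.
    set V := (2 * ((K + 1 : ℕ) : ℝ) * (c : ℝ) ^ 2 + ((K + 1 : ℕ) : ℝ) * ‖ξ‖ ^ 2 +
      2 * ((K + 1 : ℕ) : ℝ) ^ 2 * ‖ξ‖ ^ 2) / (4 * (K + 1) * (1 - δ)) with hV
    have hfin : ∫⁻ ω in Θ 0 ⁻¹' Metric.closedBall 0 (c : ℝ),
        ∑' n, ENNReal.ofReal (γ n) *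
          ENNReal.ofReal (risk ℓ (K + 1) ξ P (X 0 0) (Θ n ω)) ∂P ≤ ENNReal.ofReal V := by
      calc _ = ∑' n, ENNReal.ofReal (γ n) * ∫⁻ ω in Θ 0 ⁻¹' Metric.closedBall 0 (c : ℝ),
            ENNReal.ofReal (risk ℓ (K + 1) ξ P (X 0 0) (Θ n ω)) ∂P := by
            rw [lintegral_tsum fun n =>
              ((hrisk_meas n).ennreal_ofReal.const_mul _).aemeasurable]
            exact tsum_congr fun n => lintegral_const_mul _ (hrisk_meas n).ennreal_ofReal
        _ = ∑' n, ENNReal.ofReal (γ n) * ∫⁻ ω in Θ 0 ⁻¹' Metric.closedBall 0 (c : ℝ),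
            ENNReal.ofReal
              (empRisk ℓ (K + 1) ξ relu (M n) (fun m => X n m ω) (Θ n ω)) ∂P :=
            tsum_congr fun n => by
              rw [setLIntegral_process_eq ℓ ξ hG hΘ_step hX_meas hX_indep hX_ident hM hΘ_meas
                hΘ_indep hS n c]
        _ = ∫⁻ ω in Θ 0 ⁻¹' Metric.closedBall 0 (c : ℝ), ∑' n, ENNReal.ofReal (γ n) *
            ENNReal.ofReal
              (empRisk ℓ (K + 1) ξ relu (M n) (fun m => X n m ω) (Θ n ω)) ∂P := by
            rw [lintegral_tsum fun n =>
              ((hemp_meas n).ennreal_ofReal.const_mul _).aemeasurable]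
            exact (tsum_congr fun n =>
              lintegral_const_mul _ (hemp_meas n).ennreal_ofReal).symm
        _ ≤ ∫⁻ _ in Θ 0 ⁻¹' Metric.closedBall 0 (c : ℝ), ENNReal.ofReal V ∂P := by
            refine lintegral_mono_ae ?_
            filter_upwards [ae_restrict_mem hs, ae_restrict_of_ae hstep] with ω hω hω'
            refine ENNReal.tsum_le_of_sum_range_le fun n => ?_
            have h1 := sum_empRisk_le ℓ ξ hM (x := fun n m => X n m ω) (θ := fun n => Θ n ω)
              (g := fun n => G n (Θ n ω) ω) (fun n h => hG n _ ω h) hγ (fun n => hΘ_step n ω)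
              (fun n m => hS n m ω) hδ hω' n
            rw [Finset.sum_congr rfl fun k _ => (ENNReal.ofReal_mul (hγ k)).symm,
              ← ENNReal.ofReal_sum_of_nonneg fun k _ =>
                mul_nonneg (hγ k) (empRisk_nonneg ℓ ξ _ _ _ _)]
            refine ENNReal.ofReal_le_ofReal (h1.trans ?_)
            rw [hV]
            have h2 := lyapunov_le ℓ ξ (Θ 0 ω) (by omega)
            have h3 : ‖Θ 0 ω‖ ≤ c := by simpa using hω
            have h4 : 2 * ((K + 1 : ℕ) : ℝ) * ‖Θ 0 ω‖ ^ 2 ≤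
              2 * ((K + 1 : ℕ) : ℝ) * (c : ℝ) ^ 2 := by gcongr
            refine div_le_div_of_nonneg_right ?_ (by positivity)
            linarith
        _ ≤ ENNReal.ofReal V := by
            rw [setLIntegral_const]
            exact mul_le_of_le_one_right' prob_le_one
    have hmeas : Measurable fun ω => ∑' n, ENNReal.ofReal (γ n) *
        ENNReal.ofReal (risk ℓ (K + 1) ξ P (X 0 0) (Θ n ω)) :=
      Measurable.tsum fun n => (hrisk_meas n).ennreal_ofReal.const_mul _
    exact (ae_restrict_iff' hs).1
      (ae_lt_top hmeas (ne_top_of_le_ne_top ENNReal.ofReal_ne_top hfin))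
  filter_upwards [ae_all_iff.2 hball] with ω hω
  obtain ⟨c, hc⟩ := exists_nat_ge ‖Θ 0 ω‖
  have h := ENNReal.summable_toReal (hω c (by simpa using hc)).ne
  refine h.congr fun n => ?_
  rw [ENNReal.toReal_mul, ENNReal.toReal_ofReal (hγ n),
    ENNReal.toReal_ofReal (risk_nonneg ℓ _ ξ _ _)]

end StochasticGradientDescent

/-! ### Almost sure convergence, boundedness and convergence in mean -/

section Convergence

variable (ℓ : ℕ → ℕ) (hℓ : ∀ k, 1 ≤ ℓ k) {K : ℕ} (ξ : EuclideanSpace ℝ (Fin (ℓ (K + 1))))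
  {a b : ℝ} {Ω : Type*} [MeasurableSpace Ω] {P : Measure Ω} [IsProbabilityMeasure P]
  {X : ℕ → ℕ → Ω → EuclideanSpace ℝ (Fin (ℓ 0))} {M : ℕ → ℕ}
  (hX_meas : ∀ n m, Measurable (X n m)) (hX_mem : ∀ n m ω i, X n m ω i ∈ Set.Icc a b)
  (hX_indep : iIndepFun (fun p : ℕ × ℕ => X p.1 p.2) P)
  (hX_ident : ∀ n m, IdentDistrib (X n m) (X 0 0) P P) (hM : ∀ n, 1 ≤ M n)
  {G : ℕ → EuclideanSpace ℝ (Fin (paramCount ℓ (K + 1))) → Ω →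
    EuclideanSpace ℝ (Fin (paramCount ℓ (K + 1)))}
  (hG : ∀ n θ ω h, inner ℝ (G n θ ω) h = empTangent ℓ K ξ (M n) (fun m => X n m ω) θ h)
  {γ : ℕ → ℝ} (hγ : ∀ n, 0 ≤ γ n)
  (hγ_sum : Tendsto (fun N => ∑ n ∈ Finset.range N, γ n) atTop atTop)
  {Θ : ℕ → Ω → EuclideanSpace ℝ (Fin (paramCount ℓ (K + 1)))} (hΘ_meas : ∀ n, Measurable (Θ n))
  (hΘ_indep : IndepFun (Θ 0) (fun ω (p : ℕ × ℕ) => X p.1 p.2 ω) P)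
  (hΘ_step : ∀ n ω, Θ (n + 1) ω = Θ n ω - γ n • G n (Θ n ω) ω)
  {δ : ℝ} (hδ : δ < 1)
  (hrate : ∀ n, ∀ᵐ ω ∂P, γ n * ((K + 1 : ℕ) : ℝ) * (max (max |a| |b|) 1) ^ 2 *
    (∏ p ∈ Finset.range (K + 1 + 1), ((ℓ p : ℝ) + 1)) *
    (2 * lyapunov ℓ (K + 1) ξ (Θ 0 ω) + 4 * ((K + 1 : ℕ) : ℝ) ^ 2 * ‖ξ‖ ^ 2 + 1) ^ K ≤ δ)

theorem norm_sq_add_one_le_lyapunov (θ : EuclideanSpace ℝ (Fin (paramCount ℓ (K + 1)))) :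
    ‖θ‖ ^ 2 + 1 ≤ 2 * lyapunov ℓ (K + 1) ξ θ + 4 * ((K + 1 : ℕ) : ℝ) ^ 2 * ‖ξ‖ ^ 2 + 1 := by
  linarith [norm_sq_le_lyapunov ℓ ξ θ (by omega)]

include hℓ hγ hrate in
omit [IsProbabilityMeasure P] in
theorem ae_rate_le : ∀ᵐ ω ∂P, ∀ n, γ n * ((K + 1) ^ 2 * (2 * lyapunov ℓ (K + 1) ξ (Θ 0 ω) +
      4 * ((K + 1 : ℕ) : ℝ) ^ 2 * ‖ξ‖ ^ 2 + 1) ^ K *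
        ((max (max |a| |b|) 1) ^ 2 * ((ℓ 0 : ℝ) + 1))) ≤ δ ∧
    γ n * (2 * lyapunov ℓ (K + 1) ξ (Θ 0 ω) +
      4 * ((K + 1 : ℕ) : ℝ) ^ 2 * ‖ξ‖ ^ 2 + 1) ^ K ≤ δ := by
  filter_upwards [ae_all_iff.2 hrate] with ω hω n
  exact rate_le_of_lyapunov ℓ hℓ (hγ n) (le_max_right _ _)
    (le_trans (by nlinarith [sq_nonneg ‖Θ 0 ω‖]) (norm_sq_add_one_le_lyapunov ℓ ξ (Θ 0 ω))) (hω n)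

include hℓ hX_meas hX_mem hX_indep hX_ident hM hG hγ hγ_sum hΘ_meas hΘ_indep hΘ_step hδ hrate in
theorem ae_tendsto_risk :
    ∀ᵐ ω ∂P, Tendsto (fun n => risk ℓ (K + 1) ξ P (X 0 0) (Θ n ω)) atTop (𝓝 0) := by
  have hae := ae_rate_le ℓ hℓ ξ hγ hrate
  have hS : ∀ n m ω, ‖X n m ω‖ ^ 2 + 1 ≤ (max (max |a| |b|) 1) ^ 2 * ((ℓ 0 : ℝ) + 1) :=
    fun n m ω => norm_sq_add_one_le (hX_mem n m ω)
  filter_upwards [hae, ae_summable_risk ℓ ξ hG hΘ_step hX_meas hX_indep hX_ident hM hγ hΘ_meas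
    hΘ_indep hS hδ (hae.mono fun ω hω n => (hω n).1)] with ω hω hsum
  have hy : 1 ≤ 2 * lyapunov ℓ (K + 1) ξ (Θ 0 ω) + 4 * ((K + 1 : ℕ) : ℝ) ^ 2 * ‖ξ‖ ^ 2 + 1 :=
    le_trans (by nlinarith [sq_nonneg ‖Θ 0 ω‖]) (norm_sq_add_one_le_lyapunov ℓ ξ (Θ 0 ω))
  refine tendsto_risk_of_summable ℓ ξ hM (x := fun n m => X n m ω) (θ := fun n => Θ n ω)
    (g := fun n => G n (Θ n ω) ω) (fun n h => hG n _ ω h) hγ (fun n => hΘ_step n ω)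
    (fun n m => hS n m ω) hδ (fun n => (hω n).1) (hX_meas 0 0) (norm_data_le ℓ hS 0 0)
    (fun n => ?_) hγ_sum hsum
  -- With `y ≥ 1` the Lyapunov term, `γ n ≤ γ n * y ^ K ≤ δ < 1`.
  exact (le_mul_of_one_le_right (hγ n) (one_le_pow₀ hy)).trans ((hω n).2.trans hδ.le)

include hℓ hX_mem hM hG hγ hΘ_step hδ hrate in
omit [IsProbabilityMeasure P] in
theorem exists_ae_bound (hc : ∃ c : ℝ, ∀ᵐ ω ∂P, ‖Θ 0 ω‖ ≤ c) :
    ∃ C : ℝ, ∀ᵐ ω ∂P, ∀ n, ‖Θ n ω‖ ≤ C := by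
  obtain ⟨c, hc⟩ := hc
  refine ⟨√(2 * (2 * ((K + 1 : ℕ) : ℝ) * c ^ 2 + ((K + 1 : ℕ) : ℝ) * ‖ξ‖ ^ 2) +
    4 * ((K + 1 : ℕ) : ℝ) ^ 2 * ‖ξ‖ ^ 2), ?_⟩
  filter_upwards [hc, ae_rate_le ℓ hℓ ξ hγ hrate] with ω hω hω' n
  refine Real.le_sqrt_of_sq_le ((norm_sq_le_initial ℓ ξ hM (x := fun n m => X n m ω)
    (θ := fun n => Θ n ω) (g := fun n => G n (Θ n ω) ω) (fun n h => hG n _ ω h) hγ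
    (fun n => hΘ_step n ω) (fun n m => norm_sq_add_one_le (hX_mem n m ω)) hδ
    (fun n => (hω' n).1) n).trans ?_)
  have h1 := lyapunov_le ℓ ξ (Θ 0 ω) (by omega)
  have h2 : 2 * ((K + 1 : ℕ) : ℝ) * ‖Θ 0 ω‖ ^ 2 ≤ 2 * ((K + 1 : ℕ) : ℝ) * c ^ 2 := by gcongr
  linarith

theorem integrable_and_tendsto_integral_risk (hX : Measurable (X 0 0)) {D : ℝ}
    (hD : ∀ ω, ‖X 0 0 ω‖ ≤ D) (hΘ_meas : ∀ n, Measurable (Θ n))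
    (hbdd : ∃ C : ℝ, ∀ᵐ ω ∂P, ∀ n, ‖Θ n ω‖ ≤ C)
    (hlim : ∀ᵐ ω ∂P, Tendsto (fun n => risk ℓ (K + 1) ξ P (X 0 0) (Θ n ω)) atTop (𝓝 0)) :
    (∀ n, Integrable (fun ω => risk ℓ (K + 1) ξ P (X 0 0) (Θ n ω)) P) ∧
      Tendsto (fun n => ∫ ω, risk ℓ (K + 1) ξ P (X 0 0) (Θ n ω) ∂P) atTop (𝓝 0) := by
  obtain ⟨ρ, hρ⟩ := hbdd
  obtain ⟨C, -, h⟩ := exists_risk_lipschitz (P := P) ℓ ξ hX hD ρ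
  have hmeas : ∀ n, AEStronglyMeasurable (fun ω => risk ℓ (K + 1) ξ P (X 0 0) (Θ n ω)) P :=
    fun n => ((measurable_risk ℓ ξ hX).comp (hΘ_meas n)).aestronglyMeasurable
  have hb : ∀ n, ∀ᵐ ω ∂P, ‖risk ℓ (K + 1) ξ P (X 0 0) (Θ n ω)‖ ≤ C := by
    intro n
    filter_upwards [hρ] with ω hω
    rw [Real.norm_of_nonneg (risk_nonneg ℓ _ ξ _ _)]
    exact (h _ _ (hω n) (hω n)).1
  refine ⟨fun n => Integrable.of_bound (hmeas n) C (hb n), ?_⟩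
  simpa using tendsto_integral_of_dominated_convergence (fun _ => C) hmeas (integrable_const C)
    hb hlim

omit [MeasurableSpace Ω] in
include hγ hγ_sum in
theorem exists_rate_pos : ∃ n, 0 < γ n := by
  by_contra! hcon
  have h0 : ∀ n, γ n = 0 := fun n => le_antisymm (hcon n) (hγ n)
  simp only [h0, Finset.sum_const_zero] at hγ_sum
  exact not_tendsto_atTop_of_tendsto_nhds tendsto_const_nhds hγ_sum

include hℓ hγ hγ_sum hrate in
omit [IsProbabilityMeasure P] in
/-- For at least two layers, the bound on the learning rates bounds the initial value. -/
theorem exists_initial_bound (hK : K ≠ 0) : ∃ c : ℝ, ∀ᵐ ω ∂P, ‖Θ 0 ω‖ ≤ c := by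
  obtain ⟨n, hn⟩ := exists_rate_pos hγ hγ_sum
  -- For `K ≠ 0`, `γ n * ‖Θ 0‖ ≤ γ n * y ≤ γ n * y ^ K ≤ δ`.
  refine ⟨δ / γ n, ?_⟩
  filter_upwards [ae_rate_le ℓ hℓ ξ hγ hrate] with ω hω
  have h1 := norm_sq_add_one_le_lyapunov ℓ ξ (Θ 0 ω)
  have hy : 1 ≤ 2 * lyapunov ℓ (K + 1) ξ (Θ 0 ω) + 4 * ((K + 1 : ℕ) : ℝ) ^ 2 * ‖ξ‖ ^ 2 + 1 :=
    le_trans (by nlinarith [sq_nonneg ‖Θ 0 ω‖]) h1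
  have h2 := mul_le_mul_of_nonneg_left (le_self_pow₀ hy hK) hn.le
  rw [le_div_iff₀ hn]
  nlinarith [(hω n).2, sq_nonneg (‖Θ 0 ω‖ - 1), mul_le_mul_of_nonneg_left h1 hn.le]

end Convergence

/-- The explicit bound on the learning rates implies the bound in terms of the Lyapunov
function. -/
theorem rate_mul_le_half (ℓ : ℕ → ℕ) (hℓ : ∀ k, 1 ≤ ℓ k) {K : ℕ}
    (ξ : EuclideanSpace ℝ (Fin (ℓ (K + 1)))) (θ : EuclideanSpace ℝ (Fin (paramCount ℓ (K + 1))))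
    {γ α : ℝ} (hγ : 0 ≤ γ) (hα : 1 ≤ α)
    (h : (4 * ((K + 1 : ℕ) : ℝ) * (paramCount ℓ (K + 1) : ℝ) * max α ‖ξ‖) ^ (2 * (K + 1)) * γ ≤
      ((‖θ‖ + 1) ^ (2 * (K + 1)))⁻¹) :
    γ * ((K + 1 : ℕ) : ℝ) * α ^ 2 * (∏ p ∈ Finset.range (K + 1 + 1), ((ℓ p : ℝ) + 1)) *
      (2 * lyapunov ℓ (K + 1) ξ θ + 4 * ((K + 1 : ℕ) : ℝ) ^ 2 * ‖ξ‖ ^ 2 + 1) ^ K ≤ 1 / 2 := by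
  have hprod := prod_width_le ℓ hℓ K
  have hp : (1 : ℝ) ≤ paramCount ℓ (K + 1) := by exact_mod_cast one_le_paramCount ℓ hℓ K
  have hV := lyapunov_le ℓ ξ θ (by omega)
  have hy0 := norm_sq_add_one_le_lyapunov ℓ ξ θ
  have hL : (1 : ℝ) ≤ ((K + 1 : ℕ) : ℝ) := by push_cast; simp
  set L : ℝ := ((K + 1 : ℕ) : ℝ)
  set p : ℝ := (paramCount ℓ (K + 1) : ℝ)
  set m : ℝ := max α ‖ξ‖
  set y : ℝ := 2 * lyapunov ℓ (K + 1) ξ θ + 4 * L ^ 2 * ‖ξ‖ ^ 2 + 1 with hy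
  have hαm : α ≤ m := le_max_left _ _
  have hξm : ‖ξ‖ ≤ m := le_max_right _ _
  have hm : 1 ≤ m := hα.trans hαm
  set s : ℝ := ‖θ‖ + 1 with hs
  have hs1 : 1 ≤ s := by linarith [norm_nonneg θ]
  have hLm : 1 ≤ L * m := one_le_mul_of_one_le_of_one_le hL hm
  -- By `lyapunov_le`, `y ≤ 4 L ‖θ‖ ^ 2 + 2 L ‖ξ‖ ^ 2 + 4 L ^ 2 ‖ξ‖ ^ 2 + 1`, at most `(L m) ^ 2 *
  -- (4 ‖θ‖ ^ 2 + 7)`.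
  have hyle : y ≤ (4 * L * m * s) ^ 2 := by
    have h1 : ‖ξ‖ ^ 2 ≤ m ^ 2 := by gcongr
    have h2 : L ≤ L ^ 2 := le_self_pow₀ hL two_ne_zero
    have h3 : L * ‖ξ‖ ^ 2 ≤ (L * m) ^ 2 := by rw [mul_pow]; gcongr
    have h4 : L ^ 2 * ‖ξ‖ ^ 2 ≤ (L * m) ^ 2 := by rw [mul_pow]; gcongr
    have h5 : L ≤ (L * m) ^ 2 := h2.trans (by gcongr; exact le_mul_of_one_le_right (by linarith) hm)
    have h6 : (1 : ℝ) ≤ (L * m) ^ 2 := one_le_pow₀ hLm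
    have h7 : ‖θ‖ ^ 2 + 1 ≤ s ^ 2 := by rw [hs]; nlinarith [norm_nonneg θ]
    have h8 := mul_le_mul_of_nonneg_right h5 (sq_nonneg ‖θ‖)
    have h9 := mul_le_mul_of_nonneg_left h7 (sq_nonneg (L * m))
    have h10 : (4 * L * m * s) ^ 2 = 16 * ((L * m) ^ 2 * s ^ 2) := by ring
    rw [h10]
    nlinarith [mul_nonneg (sq_nonneg (L * m)) (sq_nonneg ‖θ‖)]
  have hyK : y ^ K ≤ ((4 * L * m * s) ^ 2) ^ K :=
    pow_le_pow_left₀ (le_trans (by positivity) hy0) hyle K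
  have hpow : p ^ (K + 1 + 1) ≤ p ^ (2 * (K + 1)) := pow_le_pow_right₀ hp (by omega)
  -- Of the `K + 1` available factors `(4 L m s) ^ 2`, `K` bound `y ^ K`; the last one bounds `L * α
  -- ^ 2` and leaves the `1 / 2` that serves as `δ`.
  have hcoef : L * α ^ 2 ≤ 1 / 2 * (4 * L * m * s) ^ 2 := by
    have h1 : α ^ 2 ≤ m ^ 2 := by gcongr
    have h2 : L ≤ L ^ 2 := le_self_pow₀ hL two_ne_zero
    have h3 : L * α ^ 2 ≤ L ^ 2 * m ^ 2 := by gcongr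
    have h4 : L ^ 2 * m ^ 2 ≤ L ^ 2 * m ^ 2 * s ^ 2 :=
      le_mul_of_one_le_right (by positivity) (one_le_pow₀ hs1)
    nlinarith [sq_nonneg (L * m * s)]
  have hγ' : γ * ((4 * L * m * s) ^ 2 * (p ^ (2 * (K + 1)) * ((4 * L * m * s) ^ 2) ^ K)) ≤ 1 := by
    have h1 := mul_le_mul_of_nonneg_right h (show 0 ≤ s ^ (2 * (K + 1)) by positivity)
    rw [inv_mul_cancel₀ (by positivity)] at h1
    refine le_trans (le_of_eq ?_) h1
    have e1 : (4 * L * p * m) ^ (2 * (K + 1)) * γ * s ^ (2 * (K + 1)) =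
        γ * (p ^ (2 * (K + 1)) * (4 * L * m * s) ^ (2 * (K + 1))) := by
      rw [mul_pow (4 * L * m) s,
        show 4 * L * p * m = p * (4 * L * m) by ring, mul_pow p]
      ring
    rw [e1, pow_mul (4 * L * m * s) 2 (K + 1), pow_succ]
    ring
  calc γ * L * α ^ 2 * (∏ q ∈ Finset.range (K + 1 + 1), ((ℓ q : ℝ) + 1)) * y ^ K
      = γ * ((L * α ^ 2) * ((∏ q ∈ Finset.range (K + 1 + 1), ((ℓ q : ℝ) + 1)) * y ^ K)) := by ring
    _ ≤ γ * ((1 / 2 * (4 * L * m * s) ^ 2) *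
          (p ^ (2 * (K + 1)) * ((4 * L * m * s) ^ 2) ^ K)) := by
        have h0 : 0 ≤ y ^ K := pow_nonneg (le_trans (by positivity) hy0) K
        have h2 := hprod.trans hpow
        gcongr
    _ = 1 / 2 * (γ * ((4 * L * m * s) ^ 2 *
          (p ^ (2 * (K + 1)) * ((4 * L * m * s) ^ 2) ^ K))) := by ring
    _ ≤ 1 / 2 := by linarith

/-- One positive rate gives `‖U‖ + 1 ≤ (‖U‖ + 1) ^ N ≤ (γ n)⁻¹`. The exponent `2 L` is nonzero also
for `L = 1`, so the explicit condition needs no separate bound on the initial value. -/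
theorem exists_initial_bound_of_explicit {E Ω : Type*} [NormedAddCommGroup E]
    [MeasurableSpace Ω] {P : Measure Ω} {U : Ω → E} {κ : ℝ} (hκ : 1 ≤ κ) {N : ℕ} (hN : N ≠ 0)
    {γ : ℕ → ℝ} (hγ : ∀ n, 0 ≤ γ n)
    (hγ_sum : Tendsto (fun N => ∑ n ∈ Finset.range N, γ n) atTop atTop)
    (h : ∀ n, ∀ᵐ ω ∂P, κ ^ N * γ n ≤ ((‖U ω‖ + 1) ^ N)⁻¹) :
    ∃ c : ℝ, ∀ᵐ ω ∂P, ‖U ω‖ ≤ c := by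
  obtain ⟨n, hn⟩ := exists_rate_pos hγ hγ_sum
  refine ⟨(γ n)⁻¹, ?_⟩
  filter_upwards [h n] with ω hω
  have h1 : γ n ≤ ((‖U ω‖ + 1) ^ N)⁻¹ :=
    (le_mul_of_one_le_left hn.le (one_le_pow₀ hκ)).trans hω
  have h2 : (‖U ω‖ + 1) ^ N ≤ (γ n)⁻¹ := (le_inv_comm₀ hn (by positivity)).1 h1
  have h3 : ‖U ω‖ + 1 ≤ (‖U ω‖ + 1) ^ N := le_self_pow₀ (by linarith [norm_nonneg (U ω)]) hN
  linarith

end DeepReLU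

theorem theorem4
    -- architecture, constant target, input cube
    (L : ℕ) (hL : 1 ≤ L) (ℓ : ℕ → ℕ) (hℓ : ∀ k, 1 ≤ ℓ k)
    (ξ : EuclideanSpace ℝ (Fin (ℓ L))) (a b : ℝ) (hab : a < b)
    -- smooth approximations of the rectifier function
    (A B : ℝ) (hA : 0 < A) (hAB : A < B)
    (R : ℝ → ℝ → ℝ) (hR : DeepReLU.IsRectifierApprox A B R)
    -- i.i.d. data in the cube
    {Ω : Type*} [MeasurableSpace Ω] (P : Measure Ω) [IsProbabilityMeasure P]
    (X : ℕ → ℕ → Ω → EuclideanSpace ℝ (Fin (ℓ 0)))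
    (hX_meas : ∀ n m, Measurable (X n m))
    (hX_mem : ∀ n m ω i, X n m ω i ∈ Set.Icc a b)
    (hX_indep : iIndepFun (fun p : ℕ × ℕ => X p.1 p.2) P)
    (hX_ident : ∀ n m, IdentDistrib (X n m) (X 0 0) P P)
    -- batch sizes
    (M : ℕ → ℕ) (hM : ∀ n, 1 ≤ M n)
    -- generalized gradients of the empirical risks
    (G : ℕ → EuclideanSpace ℝ (Fin (DeepReLU.paramCount ℓ L)) → Ω →
      EuclideanSpace ℝ (Fin (DeepReLU.paramCount ℓ L)))
    (hG : ∀ n θ ω g,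
      Tendsto (fun r : ℝ => gradient
          (DeepReLU.empRisk ℓ L ξ (DeepReLU.approxAct R r) (M n) (fun m => X n m ω)) θ)
        atTop (𝓝 g) →
      G n θ ω = g)
    -- learning rates and SGD process
    (γ : ℕ → ℝ) (hγ : ∀ n, 0 ≤ γ n)
    (hγ_sum : Tendsto (fun N => ∑ n ∈ Finset.range N, γ n) atTop atTop)
    (Θ : ℕ → Ω → EuclideanSpace ℝ (Fin (DeepReLU.paramCount ℓ L)))
    (hΘ_meas : ∀ n, Measurable (Θ n))
    (hΘ_indep : IndepFun (Θ 0) (fun ω (p : ℕ × ℕ) => X p.1 p.2 ω) P)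
    (hΘ_step : ∀ n ω, Θ (n + 1) ω = Θ n ω - γ n • G n (Θ n ω) ω) :
    -- learning rates bounded through the Lyapunov function
    (∀ δ ∈ Set.Ioo (0 : ℝ) 1,
      (∀ n, ∀ᵐ ω ∂P,
        γ n * (L : ℝ) * (max (max |a| |b|) 1) ^ 2 * (∏ p ∈ Finset.range (L + 1), ((ℓ p : ℝ) + 1))
          * (2 * DeepReLU.lyapunov ℓ L ξ (Θ 0 ω) + 4 * (L : ℝ) ^ 2 * ‖ξ‖ ^ 2 + 1) ^ (L - 1)
        ≤ δ) →
      (∀ᵐ ω ∂P, Tendsto (fun n => DeepReLU.risk ℓ L ξ P (X 0 0) (Θ n ω)) atTop (𝓝 0)) ∧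
      -- for `L = 1` the condition does not restrict the initial value
      ((L = 1 → ∃ c : ℝ, ∀ᵐ ω ∂P, ‖Θ 0 ω‖ ≤ c) →
        (∃ C : ℝ, ∀ᵐ ω ∂P, ∀ n, ‖Θ n ω‖ ≤ C) ∧
        (∀ n, Integrable (fun ω => DeepReLU.risk ℓ L ξ P (X 0 0) (Θ n ω)) P) ∧
        Tendsto (fun n => ∫ ω, DeepReLU.risk ℓ L ξ P (X 0 0) (Θ n ω) ∂P) atTop (𝓝 0))) ∧
    -- explicit bound on the learning rates
    ((∀ n, ∀ᵐ ω ∂P,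
        (4 * (L : ℝ) * (DeepReLU.paramCount ℓ L : ℝ)
            * max (max (max |a| |b|) 1) ‖ξ‖) ^ (2 * L) * γ n
          ≤ ((‖Θ 0 ω‖ + 1) ^ (2 * L))⁻¹) →
      (∃ C : ℝ, ∀ᵐ ω ∂P, ∀ n, ‖Θ n ω‖ ≤ C) ∧
      (∀ᵐ ω ∂P, Tendsto (fun n => DeepReLU.risk ℓ L ξ P (X 0 0) (Θ n ω)) atTop (𝓝 0)) ∧
      (∀ n, Integrable (fun ω => DeepReLU.risk ℓ L ξ P (X 0 0) (Θ n ω)) P) ∧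
      Tendsto (fun n => ∫ ω, DeepReLU.risk ℓ L ξ P (X 0 0) (Θ n ω) ∂P) atTop (𝓝 0)) := by
  obtain ⟨K, rfl⟩ : ∃ K, L = K + 1 := ⟨L - 1, by omega⟩
  simp only [Nat.add_sub_cancel]
  -- `G` is prescribed only where the limit exists, but the limit exists everywhere.
  have hG' : ∀ n θ ω h, inner ℝ (G n θ ω) h =
      DeepReLU.empTangent ℓ K ξ (M n) (fun m => X n m ω) θ h := by
    intro n θ ω h
    obtain ⟨g, hg, hgh⟩ := DeepReLU.exists_tendsto_gradient_empRisk ℓ ξ (M n)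
      (fun m => X n m ω) θ hR hA
    rw [hG n θ ω g hg, hgh]
  have hD := DeepReLU.norm_data_le ℓ (X := X)
    (fun n m ω => DeepReLU.norm_sq_add_one_le (hX_mem n m ω)) 0 0
  refine ⟨fun δ hδ hrate => ?_, fun hrate => ?_⟩
  · have hlim := DeepReLU.ae_tendsto_risk ℓ hℓ ξ hX_meas hX_mem hX_indep hX_ident hM hG' hγ hγ_sum
      hΘ_meas hΘ_indep hΘ_step hδ.2 hrate
    refine ⟨hlim, fun hc => ?_⟩
    have hc' : ∃ c : ℝ, ∀ᵐ ω ∂P, ‖Θ 0 ω‖ ≤ c := by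
      rcases eq_or_ne K 0 with rfl | hK
      · exact hc rfl
      · exact DeepReLU.exists_initial_bound ℓ hℓ ξ hγ hγ_sum hrate hK
    have hbdd := DeepReLU.exists_ae_bound ℓ hℓ ξ hX_mem hM hG' hγ hΘ_step hδ.2 hrate hc'
    exact ⟨hbdd, DeepReLU.integrable_and_tendsto_integral_risk ℓ ξ (hX_meas 0 0) hD hΘ_meas hbdd
      hlim⟩
  · have hrate' := fun n => (hrate n).mono fun ω hω =>
      DeepReLU.rate_mul_le_half ℓ hℓ ξ (Θ 0 ω) (hγ n) (le_max_right _ _) hω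
    have hκ : 1 ≤ 4 * ((K + 1 : ℕ) : ℝ) * (DeepReLU.paramCount ℓ (K + 1) : ℝ) *
        max (max (max |a| |b|) 1) ‖ξ‖ := by
      have h1 : (1 : ℝ) ≤ DeepReLU.paramCount ℓ (K + 1) := by
        exact_mod_cast DeepReLU.one_le_paramCount ℓ hℓ K
      have h2 : (1 : ℝ) ≤ 4 * ((K + 1 : ℕ) : ℝ) := by
        push_cast
        linarith [Nat.cast_nonneg (α := ℝ) K]
      have h3 : 1 ≤ max (max (max |a| |b|) 1) ‖ξ‖ := le_max_of_le_left (le_max_right _ _)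
      exact one_le_mul_of_one_le_of_one_le (one_le_mul_of_one_le_of_one_le h2 h1) h3
    have hlim := DeepReLU.ae_tendsto_risk ℓ hℓ ξ hX_meas hX_mem hX_indep hX_ident hM hG' hγ hγ_sum
      hΘ_meas hΘ_indep hΘ_step one_half_lt_one hrate'
    have hbdd := DeepReLU.exists_ae_bound ℓ hℓ ξ hX_mem hM hG' hγ hΘ_step one_half_lt_one hrate'
      (DeepReLU.exists_initial_bound_of_explicit hκ (by omega) hγ hγ_sum hrate)
    exact ⟨hbdd, hlim, DeepReLU.integrable_and_tendsto_integral_risk ℓ ξ (hX_meas 0 0) hD hΘ_meas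
      hbdd hlim⟩
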